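/- Let $k$ be a field of characteristic $0$. For a $k[\mathbb S_2]$-module $V$, regarded as an $\mathbb S$-module concentrated in arity $2$, let $\mathcal F(V)$ be the free (symmetric) operad on $V$; its weight-two part (trees with two vertices) is $\mathcal F_{(2)}(V)=\mathcal F(V)(3)$. For an $\mathbb S_3$-submodule $R\subset\mathcal F(V)(3)$, the Koszul dual of the quadratic operad $\mathcal P=\mathcal F(V)/(R)$ is $\mathcal P^!=\mathcal F(V^\vee)/(R^\perp)$, where $V^\vee=V^*\otimes\mathrm{sgn}_{\mathbb S_2}$ and $R^\perp$ is the orthogonal of $R$ for the standard (sign-equivariant) pairing $\mathcal F(V^\vee)(3)\otimes\mathcal F(V)(3)\to k$. Let $\mathcal ComTrias=\mathcal F(V)/(R)$ with $V=*\,.k[\mathbb S_2]\oplus\bullet\,.k$ (so $x\bullet y=y\bullet x$), where $R$ is the $\mathbb S_3$-submodule generated by the relations $$(x*y)*z=x*(y*z)=x*(z*y),\quad (x\bullet y)\bullet z=x\bullet(y\bullet z),\quad x*(y\bullet z)=x*(y*z),\quad (x\bullet y)*z=x\bullet(y*z).$$ Let $\mathcal PostLie=\mathcal F(W)/(S)$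 with $W=\circ\,.k[\mathbb S_2]\oplus[\,,]\,.\mathrm{sgn}_{\mathbb S_2}$ (so $[x,y]=-[y,x]$), where $S$ is the $\mathbb S_3$-submodule generated by the relations $$[x,[y,z]]+[y,[z,x]]+[z,[x,y]]=0,$$ $$(x\circ y)\circ z-x\circ(y\circ z)-(x\circ z)\circ y+x\circ(z\circ y)=x\circ[y,z],\qquad [x,y]\circ z=[x\circ z,y]+[x,y\circ z].$$ **Theorem.** The Koszul dual operad of $\mathcal ComTrias$ is $\mathcal PostLie$. More precisely, there is an isomorphism of $\mathbb S_2$-modules $V^\vee\cong W$ which sends the linear dual of $*$ to $\circ$ and the linear dual of $\bullet$ to $[\,,]$ (dual with respect to the basis $*,\ *^{(1\,2)},\ \bullet$ of $V$); the induced map $\mathcal F(V^\vee)(3)\to\mathcal F(W)(3)$ carries $R^\perp$ onto $S$; and there is an isomorphism of operads $\mathcal ComTrias^!=\mathcal F(V^\vee)/(R^\perp)\cong\mathcal F(W)/(S)=\mathcal PostLie$ which on generating operations is the isomorphism $V^\vee\cong W$. Moreover $\mathcal F(V)(3)$ has rank $27$, $R$ has rank $20$, and $S$ has rank $7=27-20$.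 -/

import Mathlib

universe u

open scoped TensorProduct

noncomputable section

/-! ### Symmetric operads -/

/-- A (symmetric, algebraic) operad over `k`, i.e. a monoid in `(𝕊-Mod, ∘, I)`.  The modules
`P(n)` carry right actions of the symmetric groups.  The composition map `μ : P ∘ P → P` is given
on the generators `p ⊗ (q_1 ⊗ ⋯ ⊗ q_m) ⊗ e` of `(P ∘ P)(N)`, where the bijection `e` numbers the
inputs of `q_1, …, q_m` by `1, …, N`: the `j`-th input of `q_i` becomes the input `e ⟨i, j⟩` of the
composite.  𝕊-modules are indexed by positive integers; equivalently, `P(0) = 0`. -/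
structure Operad (k : Type u) [CommRing k] where
  obj : ℕ → Type u
  [addCommGroup : ∀ n, AddCommGroup (obj n)]
  [module : ∀ n, Module k (obj n)]
  subsingleton_zero : Subsingleton (obj 0)
  /-- `act σ p = p · σ` -/
  act : ∀ {n : ℕ}, Equiv.Perm (Fin n) → obj n →ₗ[k] obj n
  act_one : ∀ {n : ℕ} (p : obj n), act 1 p = p
  act_mul : ∀ {n : ℕ} (σ τ : Equiv.Perm (Fin n)) (p : obj n), act (σ * τ) p = act τ (act σ p)
  one : obj 1
  comp : ∀ {m : ℕ} {n : Fin m → ℕ} {N : ℕ}, ((Σ i, Fin (n i)) ≃ Fin N) →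
    obj m → (∀ i, obj (n i)) → obj N
  comp_add_left : ∀ {m : ℕ} {n : Fin m → ℕ} {N : ℕ} (e : (Σ i, Fin (n i)) ≃ Fin N)
    (p p' : obj m) (q : ∀ i, obj (n i)), comp e (p + p') q = comp e p q + comp e p' q
  comp_smul_left : ∀ {m : ℕ} {n : Fin m → ℕ} {N : ℕ} (e : (Σ i, Fin (n i)) ≃ Fin N)
    (c : k) (p : obj m) (q : ∀ i, obj (n i)), comp e (c • p) q = c • comp e p q
  comp_update_add : ∀ {m : ℕ} {n : Fin m → ℕ} {N : ℕ} (e : (Σ i, Fin (n i)) ≃ Fin N)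
    (p : obj m) (q : ∀ i, obj (n i)) (i : Fin m) (x y : obj (n i)),
    comp e p (Function.update q i (x + y)) =
      comp e p (Function.update q i x) + comp e p (Function.update q i y)
  comp_update_smul : ∀ {m : ℕ} {n : Fin m → ℕ} {N : ℕ} (e : (Σ i, Fin (n i)) ≃ Fin N)
    (p : obj m) (q : ∀ i, obj (n i)) (i : Fin m) (c : k) (x : obj (n i)),
    comp e p (Function.update q i (c • x)) = c • comp e p (Function.update q i x)
  /-- `μ` is equivariant. -/
  act_comp : ∀ {m : ℕ} {n : Fin m → ℕ} {N : ℕ} (e : (Σ i, Fin (n i)) ≃ Fin N)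
    (σ : Equiv.Perm (Fin N)) (p : obj m) (q : ∀ i, obj (n i)),
    act σ (comp e p q) = comp (e.trans σ.symm) p q
  /-- `μ` is well defined on the tensor product over the groups `𝕊_{n_1} × ⋯ × 𝕊_{n_m}`. -/
  comp_act_right : ∀ {m : ℕ} {n : Fin m → ℕ} {N : ℕ} (e : (Σ i, Fin (n i)) ≃ Fin N)
    (σ : ∀ i, Equiv.Perm (Fin (n i))) (p : obj m) (q : ∀ i, obj (n i)),
    comp e p (fun i => act (σ i) (q i)) =
      comp ((Equiv.sigmaCongrRight fun i => (σ i).symm).trans e) p q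
  /-- `μ` is well defined on the coinvariants under `𝕊_m`. -/
  comp_act_left : ∀ {m : ℕ} {n : Fin m → ℕ} {N : ℕ} (e : (Σ i, Fin (n i)) ≃ Fin N)
    (ν : Equiv.Perm (Fin m)) (p : obj m) (q : ∀ i, obj (n i)),
    comp e (act ν p) q =
      comp ((Equiv.sigmaCongrLeft (β := fun i => Fin (n i)) ν.symm).trans e) p
        (fun i => q (ν.symm i))
  one_comp : ∀ {n : ℕ} (p : obj n),
    comp (Equiv.uniqueSigma fun _ : Fin 1 => Fin n) one (fun _ => p) = p
  comp_one : ∀ {n : ℕ} (p : obj n),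
    comp (Equiv.sigmaUnique (Fin n) fun _ => Fin 1) p (fun _ => one) = p
  assoc : ∀ {m : ℕ} {n : Fin m → ℕ} {l : ∀ i, Fin (n i) → ℕ} {L : Fin m → ℕ} {M N : ℕ}
    (c : (Σ i, Fin (n i)) ≃ Fin M) (d : ∀ i, (Σ j, Fin (l i j)) ≃ Fin (L i))
    (e : (Σ i, Fin (L i)) ≃ Fin N)
    (p : obj m) (q : ∀ i, obj (n i)) (r : ∀ i j, obj (l i j)),
    comp e p (fun i => comp (d i) (q i) (r i)) =
      comp
        ((((Equiv.sigmaCongrLeft (β := fun x : Σ i, Fin (n i) => Fin (l x.1 x.2)) c.symm).trans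
          (Equiv.sigmaAssoc fun i j => Fin (l i j))).trans (Equiv.sigmaCongrRight d)).trans e)
        (comp c p q) (fun x => r (c.symm x).1 (c.symm x).2)

attribute [instance] Operad.addCommGroup Operad.module

namespace Operad

variable {k : Type u} [CommRing k]

/-- Isomorphisms of operads. -/
structure Iso (P Q : Operad k) where
  equiv : ∀ n, P.obj n ≃ₗ[k] Q.obj n
  map_act : ∀ {n : ℕ} (σ : Equiv.Perm (Fin n)) (p : P.obj n),
    equiv n (P.act σ p) = Q.act σ (equiv n p)
  map_one : equiv 1 P.one = Q.one
  map_comp : ∀ {m : ℕ} {n : Fin m → ℕ} {N : ℕ} (e : (Σ i, Fin (n i)) ≃ Fin N)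
    (p : P.obj m) (q : ∀ i, P.obj (n i)),
    equiv N (P.comp e p q) = Q.comp e (equiv m p) (fun i => equiv (n i) (q i))

/-- Operadic ideals. -/
structure Ideal (P : Operad k) where
  carrier : ∀ n, Submodule k (P.obj n)
  act_mem : ∀ {n : ℕ} (σ : Equiv.Perm (Fin n)) (p : P.obj n),
    p ∈ carrier n → P.act σ p ∈ carrier n
  comp_mem_left : ∀ {m : ℕ} {n : Fin m → ℕ} {N : ℕ} (e : (Σ i, Fin (n i)) ≃ Fin N)
    (p : P.obj m) (q : ∀ i, P.obj (n i)), p ∈ carrier m → P.comp e p q ∈ carrier N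
  comp_mem_right : ∀ {m : ℕ} {n : Fin m → ℕ} {N : ℕ} (e : (Σ i, Fin (n i)) ≃ Fin N)
    (p : P.obj m) (q : ∀ i, P.obj (n i)) (i : Fin m),
    q i ∈ carrier (n i) → P.comp e p q ∈ carrier N

/-- The operadic ideal generated by a family of sets of operations. -/
def Ideal.span (P : Operad k) (R : ∀ n, Set (P.obj n)) : P.Ideal where
  carrier n := ⨅ (J : P.Ideal) (_ : ∀ m, R m ⊆ J.carrier m), J.carrier n
  act_mem σ p hp := by
    simp only [Submodule.mem_iInf] at hp ⊢
    exact fun J hJ => J.act_mem σ p (hp J hJ)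
  comp_mem_left e p q hp := by
    simp only [Submodule.mem_iInf] at hp ⊢
    exact fun J hJ => J.comp_mem_left e p q (hp J hJ)
  comp_mem_right e p q i hq := by
    simp only [Submodule.mem_iInf] at hq ⊢
    exact fun J hJ => J.comp_mem_right e p q i (hq J hJ)

lemma comp_sub_left (P : Operad k) {m : ℕ} {n : Fin m → ℕ} {N : ℕ}
    (e : (Σ i, Fin (n i)) ≃ Fin N) (p p' : P.obj m) (q : ∀ i, P.obj (n i)) :
    P.comp e (p - p') q = P.comp e p q - P.comp e p' q := by
  rw [eq_sub_iff_add_eq, ← P.comp_add_left, sub_add_cancel]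

lemma comp_update_sub (P : Operad k) {m : ℕ} {n : Fin m → ℕ} {N : ℕ}
    (e : (Σ i, Fin (n i)) ≃ Fin N) (p : P.obj m) (q : ∀ i, P.obj (n i)) (i : Fin m)
    (x y : P.obj (n i)) :
    P.comp e p (Function.update q i (x - y)) =
      P.comp e p (Function.update q i x) - P.comp e p (Function.update q i y) := by
  rw [eq_sub_iff_add_eq, ← P.comp_update_add, sub_add_cancel]

lemma Ideal.comp_congr {P : Operad k} (I : P.Ideal) {m : ℕ} {n : Fin m → ℕ} {N : ℕ}
    (e : (Σ i, Fin (n i)) ≃ Fin N) {p p' : P.obj m} {q q' : ∀ i, P.obj (n i)}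
    (hp : p - p' ∈ I.carrier m) (hq : ∀ i, q i - q' i ∈ I.carrier (n i)) :
    P.comp e p q - P.comp e p' q' ∈ I.carrier N := by
  have key : ∀ s : Finset (Fin m),
      P.comp e p' q - P.comp e p' (s.piecewise q' q) ∈ I.carrier N := by
    intro s
    induction s using Finset.induction_on with
    | empty => simp
    | insert i s hi ih =>
      rw [Finset.piecewise_insert]
      have h1 : P.comp e p' (s.piecewise q' q) -
          P.comp e p' (Function.update (s.piecewise q' q) i (q' i)) ∈ I.carrier N := by
        have h2 : P.comp e p' (s.piecewise q' q) =
            P.comp e p' (Function.update (s.piecewise q' q) i (q i)) := by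
          congr 1
          rw [eq_comm, Function.update_eq_self_iff]
          simp [hi]
        rw [h2, ← P.comp_update_sub]
        exact I.comp_mem_right e p' _ i (by simpa using hq i)
      have := add_mem ih h1
      simpa using this
  have h1 := key Finset.univ
  rw [Finset.piecewise_univ] at h1
  have h2 := I.comp_mem_left e (p - p') q hp
  rw [P.comp_sub_left] at h2
  have := add_mem h2 h1
  simpa using this

/-- A representative of a class. -/
def Ideal.rep {P : Operad k} (I : P.Ideal) {n : ℕ} (x : P.obj n ⧸ I.carrier n) : P.obj n :=
  Function.surjInv (I.carrier n).mkQ_surjective x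

lemma Ideal.mk_rep {P : Operad k} (I : P.Ideal) {n : ℕ} (x : P.obj n ⧸ I.carrier n) :
    Submodule.Quotient.mk (I.rep x) = x :=
  Function.surjInv_eq (I.carrier n).mkQ_surjective x

lemma Ideal.exists_rep {P : Operad k} (I : P.Ideal) {m : ℕ} {n : Fin m → ℕ}
    (q : ∀ i, P.obj (n i) ⧸ I.carrier (n i)) :
    ∃ q' : ∀ i, P.obj (n i), q = fun i => Submodule.Quotient.mk (q' i) :=
  ⟨fun i => I.rep (q i), funext fun i => (I.mk_rep (q i)).symm⟩

/-- Composition on the quotient by an ideal. -/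
def Ideal.quotComp {P : Operad k} (I : P.Ideal) {m : ℕ} {n : Fin m → ℕ} {N : ℕ}
    (e : (Σ i, Fin (n i)) ≃ Fin N) (p : P.obj m ⧸ I.carrier m)
    (q : ∀ i, P.obj (n i) ⧸ I.carrier (n i)) : P.obj N ⧸ I.carrier N :=
  Submodule.Quotient.mk (P.comp e (I.rep p) fun i => I.rep (q i))

lemma Ideal.quotComp_mk {P : Operad k} (I : P.Ideal) {m : ℕ} {n : Fin m → ℕ} {N : ℕ}
    (e : (Σ i, Fin (n i)) ≃ Fin N) (p : P.obj m) (q : ∀ i, P.obj (n i)) :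
    I.quotComp e (Submodule.Quotient.mk p) (fun i => Submodule.Quotient.mk (q i)) =
      Submodule.Quotient.mk (P.comp e p q) := by
  rw [Ideal.quotComp, Submodule.Quotient.eq]
  refine I.comp_congr e ?_ fun i => ?_ <;>
    exact (Submodule.Quotient.eq _).1 (I.mk_rep _)

lemma Ideal.mk_update {P : Operad k} (I : P.Ideal) {m : ℕ} {n : Fin m → ℕ}
    (q : ∀ i, P.obj (n i)) (i : Fin m) (x : P.obj (n i)) :
    Function.update (fun i => (Submodule.Quotient.mk (q i) : P.obj (n i) ⧸ I.carrier (n i))) i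
      (Submodule.Quotient.mk x) =
    fun j => Submodule.Quotient.mk (Function.update q i x j) := by
  funext j
  by_cases h : j = i
  · subst h; simp
  · simp [h]

/-- The quotient operad `P / I`. -/
def quotient (P : Operad k) (I : P.Ideal) : Operad k where
  obj n := P.obj n ⧸ I.carrier n
  subsingleton_zero := by
    have := P.subsingleton_zero
    exact (I.carrier 0).mkQ_surjective.subsingleton
  act σ := Submodule.mapQ _ _ (P.act σ) fun p hp => I.act_mem σ p hp
  act_one p := by
    obtain ⟨p, rfl⟩ := Submodule.Quotient.mk_surjective _ p
    simp [P.act_one]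
  act_mul σ τ p := by
    obtain ⟨p, rfl⟩ := Submodule.Quotient.mk_surjective _ p
    simp [P.act_mul]
  one := Submodule.Quotient.mk P.one
  comp e p q := I.quotComp e p q
  comp_add_left e p p' q := by
    obtain ⟨p, rfl⟩ := Submodule.Quotient.mk_surjective _ p
    obtain ⟨p', rfl⟩ := Submodule.Quotient.mk_surjective _ p'
    obtain ⟨q, rfl⟩ := I.exists_rep q
    rw [← Submodule.Quotient.mk_add]
    simp only [I.quotComp_mk, P.comp_add_left]
    rw [Submodule.Quotient.mk_add]
  comp_smul_left e c p q := by
    obtain ⟨p, rfl⟩ := Submodule.Quotient.mk_surjective _ p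
    obtain ⟨q, rfl⟩ := I.exists_rep q
    rw [← Submodule.Quotient.mk_smul]
    simp only [I.quotComp_mk, P.comp_smul_left]
    rw [Submodule.Quotient.mk_smul]
  comp_update_add e p q i x y := by
    obtain ⟨p, rfl⟩ := Submodule.Quotient.mk_surjective _ p
    obtain ⟨x, rfl⟩ := Submodule.Quotient.mk_surjective _ x
    obtain ⟨y, rfl⟩ := Submodule.Quotient.mk_surjective _ y
    obtain ⟨q, rfl⟩ := I.exists_rep q
    rw [← Submodule.Quotient.mk_add]
    simp only [I.mk_update, I.quotComp_mk, P.comp_update_add]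
    rw [Submodule.Quotient.mk_add]
  comp_update_smul e p q i c x := by
    obtain ⟨p, rfl⟩ := Submodule.Quotient.mk_surjective _ p
    obtain ⟨x, rfl⟩ := Submodule.Quotient.mk_surjective _ x
    obtain ⟨q, rfl⟩ := I.exists_rep q
    rw [← Submodule.Quotient.mk_smul]
    simp only [I.mk_update, I.quotComp_mk, P.comp_update_smul]
    rw [Submodule.Quotient.mk_smul]
  act_comp e σ p q := by
    obtain ⟨p, rfl⟩ := Submodule.Quotient.mk_surjective _ p
    obtain ⟨q, rfl⟩ := I.exists_rep q
    simp only [I.quotComp_mk, Submodule.mapQ_apply, P.act_comp]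
  comp_act_right e σ p q := by
    obtain ⟨p, rfl⟩ := Submodule.Quotient.mk_surjective _ p
    obtain ⟨q, rfl⟩ := I.exists_rep q
    simp only [Submodule.mapQ_apply, I.quotComp_mk, P.comp_act_right]
  comp_act_left e ν p q := by
    obtain ⟨p, rfl⟩ := Submodule.Quotient.mk_surjective _ p
    obtain ⟨q, rfl⟩ := I.exists_rep q
    simp only [Submodule.mapQ_apply, I.quotComp_mk, P.comp_act_left]
  one_comp p := by
    obtain ⟨p, rfl⟩ := Submodule.Quotient.mk_surjective _ p
    exact (I.quotComp_mk _ P.one fun _ => p).trans (by rw [P.one_comp])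
  comp_one p := by
    obtain ⟨p, rfl⟩ := Submodule.Quotient.mk_surjective _ p
    exact (I.quotComp_mk _ p fun _ => P.one).trans (by rw [P.comp_one])
  assoc c d e p q r := by
    obtain ⟨p, rfl⟩ := Submodule.Quotient.mk_surjective _ p
    obtain ⟨q, rfl⟩ := I.exists_rep q
    obtain ⟨r, rfl⟩ : ∃ r', r = fun i j => Submodule.Quotient.mk (r' i j) :=
      ⟨fun i j => I.rep (r i j), funext fun i => funext fun j => (I.mk_rep (r i j)).symm⟩
    simp only [I.quotComp_mk, P.assoc c d e]

end Operad

/-! ### The free operad on an `𝕊`-module concentrated in arity two -/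

/-- A `k[𝕊_2]`-module: a `k`-module with the linear involution by which the transposition acts
(left and right `𝕊_2`-modules are the same).  It is regarded as an 𝕊-module in arity `2`. -/
structure SymTwoModule (k : Type u) [CommRing k] where
  carrier : Type u
  [addCommGroup : AddCommGroup carrier]
  [module : Module k carrier]
  swap : carrier →ₗ[k] carrier
  swap_swap : ∀ v, swap (swap v) = v

attribute [instance] SymTwoModule.addCommGroup SymTwoModule.module

/-- Isomorphisms of `k[𝕊_2]`-modules. -/
structure SymTwoModule.Iso {k : Type u} [CommRing k] (V W : SymTwoModule k) where
  equiv : V.carrier ≃ₗ[k] W.carrier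
  map_swap : ∀ v, equiv (V.swap v) = W.swap (equiv v)

/-- The Czech dual `V^∨ = V^* ⊗ sgn`. -/
abbrev SymTwoModule.czechDual {k : Type u} [CommRing k] (V : SymTwoModule k) : SymTwoModule k where
  carrier := Module.Dual k V.carrier
  swap := -Module.Dual.transpose V.swap
  swap_swap f := by
    ext v
    simp [Module.Dual.transpose_apply, V.swap_swap]

/-- Planar binary trees with vertices labelled by `V` and leaves labelled by `α`. -/
inductive BinTree (V : Type u) (α : Type) : Type u
  | leaf (a : α) : BinTree V α
  | node (v : V) (s t : BinTree V α) : BinTree V α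

namespace BinTree

variable {V : Type u} {α β : Type}

/-- The number of leaves with the label `a`. -/
def occ [DecidableEq α] (a : α) : BinTree V α → ℕ
  | leaf b => if b = a then 1 else 0
  | node _ s t => occ a s + occ a t

/-- Evaluation of a tree, for a given interpretation of the vertices as binary operations. -/
def eval {B : Type*} (mul : V → B → B → B) (f : α → B) : BinTree V α → B
  | leaf a => f a
  | node v s t => mul v (eval mul f s) (eval mul f t)

end BinTree

/-- A `k`-module `B` with binary operations indexed by `V`, that is a morphism of
`k[𝕊_2]`-modules `V → Hom(B ⊗ B, B)`. -/
structure GenAlgebra {k : Type u} [CommRing k] (V : SymTwoModule k) (B : Type*)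
    [AddCommGroup B] [Module k B] where
  mul : V.carrier → B → B → B
  add_mul' : ∀ v w x y, mul (v + w) x y = mul v x y + mul w x y
  smul_mul' : ∀ (c : k) v x y, mul (c • v) x y = c • mul v x y
  mul_add_left : ∀ v x x' y, mul v (x + x') y = mul v x y + mul v x' y
  mul_smul_left : ∀ v (c : k) x y, mul v (c • x) y = c • mul v x y
  mul_add_right : ∀ v x y y', mul v x (y + y') = mul v x y + mul v x y'
  mul_smul_right : ∀ v (c : k) x y, mul v x (c • y) = c • mul v x y
  mul_swap : ∀ v x y, mul (V.swap v) x y = mul v y x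

namespace FreeGen

variable {k : Type u} [CommRing k] (V : SymTwoModule k) (α : Type)

/-- Formal linear combinations of trees. -/
abbrev Pre : Type u := BinTree V.carrier α →₀ k

variable {V α}

/-- The linear map `x ↦ v(x, t)`. -/
def preLeft (v : V.carrier) (t : BinTree V.carrier α) : Pre V α →ₗ[k] Pre V α :=
  Finsupp.lmapDomain k k fun s => BinTree.node v s t

/-- The linear map `x ↦ v(s, x)`. -/
def preRight (v : V.carrier) (s : BinTree V.carrier α) : Pre V α →ₗ[k] Pre V α :=
  Finsupp.lmapDomain k k fun t => BinTree.node v s t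

variable (V α)

/-- The relations between trees, imposed at any vertex: linearity in the label of the vertex, and
the identification of `(v · (12))(s, t)` with `v(t, s)`. -/
inductive IsRel : Pre V α → Prop
  | add (v w : V.carrier) (s t : BinTree V.carrier α) :
      IsRel (Finsupp.single (.node (v + w) s t) 1 -
        (Finsupp.single (.node v s t) 1 + Finsupp.single (.node w s t) 1))
  | smul (c : k) (v : V.carrier) (s t : BinTree V.carrier α) :
      IsRel (Finsupp.single (.node (c • v) s t) 1 - c • Finsupp.single (.node v s t) 1)
  | swap (v : V.carrier) (s t : BinTree V.carrier α) :
      IsRel (Finsupp.single (.node (V.swap v) s t) 1 - Finsupp.single (.node v t s) 1)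
  | left (v : V.carrier) (t : BinTree V.carrier α) (x : Pre V α) :
      IsRel x → IsRel (preLeft v t x)
  | right (v : V.carrier) (s : BinTree V.carrier α) (x : Pre V α) :
      IsRel x → IsRel (preRight v s x)

/-- The span of the relations. -/
def relSpan : Submodule k (Pre V α) := Submodule.span k {x | IsRel V α x}

/-- The `k`-module of trees with vertices labelled by `V` and leaves labelled by `α`.  With the
operations `v(x, y)` it is the free algebra on the set `α` over the free operad on `V`. -/
abbrev Carrier : Type u := Pre V α ⧸ relSpan V α

variable {V α} {β γ : Type}

/-- The class of a tree. -/
def mk (t : BinTree V.carrier α) : Carrier V α := Submodule.Quotient.mk (Finsupp.single t 1)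

/-- The generator with label `a`. -/
def X (a : α) : Carrier V α := mk (.leaf a)

lemma hom_ext {B : Type*} [AddCommGroup B] [Module k B] {f g : Carrier V α →ₗ[k] B}
    (h : ∀ t, f (mk t) = g (mk t)) : f = g := by
  refine Submodule.linearMap_qext _ (Finsupp.lhom_ext' fun t => LinearMap.ext_ring ?_)
  exact h t

lemma mk_eq_zero_of_rel {x : Pre V α} (h : IsRel V α x) :
    (Submodule.Quotient.mk x : Carrier V α) = 0 :=
  (Submodule.Quotient.mk_eq_zero _).2 (Submodule.subset_span h)

/-- The linear map `x ↦ v(x, t)` on classes. -/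
def mulLeft (v : V.carrier) (t : BinTree V.carrier α) : Carrier V α →ₗ[k] Carrier V α :=
  Submodule.mapQ _ _ (preLeft v t)
    (Submodule.span_le.2 fun x hx => Submodule.subset_span (IsRel.left v t x hx))

/-- The linear map `x ↦ v(s, x)` on classes. -/
def mulRight (v : V.carrier) (s : BinTree V.carrier α) : Carrier V α →ₗ[k] Carrier V α :=
  Submodule.mapQ _ _ (preRight v s)
    (Submodule.span_le.2 fun x hx => Submodule.subset_span (IsRel.right v s x hx))

lemma mulLeft_mk (v : V.carrier) (s t : BinTree V.carrier α) :
    mulLeft v t (mk s) = mk (.node v s t) := by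
  simp [mulLeft, mk, preLeft]

lemma mulRight_mk (v : V.carrier) (s t : BinTree V.carrier α) :
    mulRight v s (mk t) = mk (.node v s t) := by
  simp [mulRight, mk, preRight]

/-- The bilinear operation `(x, y) ↦ v(x, y)`. -/
def mulHom (v : V.carrier) : Carrier V α →ₗ[k] Carrier V α →ₗ[k] Carrier V α :=
  Submodule.liftQ _ (Finsupp.linearCombination k (mulRight v)) (by
    refine Submodule.span_le.2 fun x hx => ?_
    refine hom_ext fun t => ?_
    have h : ∀ x : Pre V α, Finsupp.linearCombination k (mulRight v) x (mk t) =
        mulLeft v t (Submodule.Quotient.mk x) := by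
      intro x
      induction x using Finsupp.induction_linear with
      | zero => simp
      | add f g hf hg => simp only [map_add, LinearMap.add_apply, hf, hg, Submodule.Quotient.mk_add]
      | single s c =>
        have : (Finsupp.single s c : Pre V α) = c • Finsupp.single s 1 := by simp
        rw [this, map_smul, LinearMap.smul_apply, Submodule.Quotient.mk_smul, map_smul]
        congr 1
        rw [Finsupp.linearCombination_single, one_smul, mulRight_mk]
        exact (mulLeft_mk v s t).symm
    rw [h, mk_eq_zero_of_rel hx, map_zero, LinearMap.zero_apply])

lemma mulHom_mk (v : V.carrier) (s t : BinTree V.carrier α) :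
    mulHom v (mk s) (mk t) = mk (.node v s t) := by
  have : mulHom v (mk s) = mulRight v s := by
    refine (Submodule.liftQ_apply _ _ _).trans ?_
    simp
  rw [this, mulRight_mk]

lemma induction_mk {p : Carrier V α → Prop} (h0 : p 0) (hadd : ∀ x y, p x → p y → p (x + y))
    (hsmul : ∀ (c : k) t, p (c • mk t)) (x : Carrier V α) : p x := by
  obtain ⟨x, rfl⟩ := Submodule.Quotient.mk_surjective _ x
  induction x using Finsupp.induction_linear with
  | zero => exact h0
  | add f g hf hg => exact hadd _ _ hf hg
  | single s c =>
    have : (Finsupp.single s c : Pre V α) = c • Finsupp.single s 1 := by simp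
    rw [this]
    exact hsmul c s

variable (V α) in
/-- The operations on the module of trees. -/
def alg : GenAlgebra V (Carrier V α) where
  mul v x y := mulHom v x y
  add_mul' v w x y := by
    have : (mulHom (v + w) : Carrier V α →ₗ[k] _) = mulHom v + mulHom w := by
      refine hom_ext fun s => hom_ext fun t => ?_
      simp only [LinearMap.add_apply, mulHom_mk]
      have h := mk_eq_zero_of_rel (IsRel.add (V := V) v w s t)
      rw [Submodule.Quotient.mk_sub, sub_eq_zero] at h
      exact h
    rw [this]; rfl
  smul_mul' c v x y := by
    have : (mulHom (c • v) : Carrier V α →ₗ[k] _) = c • mulHom v := by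
      refine hom_ext fun s => hom_ext fun t => ?_
      simp only [LinearMap.smul_apply, mulHom_mk]
      have h := mk_eq_zero_of_rel (IsRel.smul (V := V) c v s t)
      rw [Submodule.Quotient.mk_sub, sub_eq_zero] at h
      exact h
    rw [this]; rfl
  mul_add_left v x x' y := by simp
  mul_smul_left v c x y := by simp
  mul_add_right v x y y' := by simp
  mul_smul_right v c x y := by simp
  mul_swap v x y := by
    have : (mulHom (V.swap v) : Carrier V α →ₗ[k] _) = (mulHom v).flip := by
      refine hom_ext fun s => hom_ext fun t => ?_
      simp only [LinearMap.flip_apply, mulHom_mk]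
      have h := mk_eq_zero_of_rel (IsRel.swap (V := V) v s t)
      rw [Submodule.Quotient.mk_sub, sub_eq_zero] at h
      exact h
    rw [this]; rfl

/-- The operation `v(x, y)`. -/
def mul (v : V.carrier) (x y : Carrier V α) : Carrier V α := (alg V α).mul v x y

lemma mul_mk (v : V.carrier) (s t : BinTree V.carrier α) :
    mul v (mk s) (mk t) = mk (.node v s t) := mulHom_mk v s t

section lift

variable {B : Type*} [AddCommGroup B] [Module k B]

/-- The morphism of algebras extending a map on the generators. -/
def lift (A : GenAlgebra V B) (f : α → B) : Carrier V α →ₗ[k] B :=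
  Submodule.liftQ _ (Finsupp.linearCombination k (BinTree.eval A.mul f)) (by
    refine Submodule.span_le.2 fun x hx => ?_
    have hl : ∀ v t (x : Pre V α), Finsupp.linearCombination k (BinTree.eval A.mul f)
        (preLeft v t x) = A.mul v (Finsupp.linearCombination k (BinTree.eval A.mul f) x)
          (BinTree.eval A.mul f t) := by
      intro v t x
      have h0 : ∀ y, A.mul v 0 y = 0 := fun y => by simpa using A.mul_smul_left v 0 0 y
      induction x using Finsupp.induction_linear with
      | zero => simp [h0]
      | add p q hp hq => simp only [map_add, hp, hq, A.mul_add_left]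
      | single s c => simp [preLeft, BinTree.eval, A.mul_smul_left]
    have hr : ∀ v t (x : Pre V α), Finsupp.linearCombination k (BinTree.eval A.mul f)
        (preRight v t x) = A.mul v (BinTree.eval A.mul f t)
          (Finsupp.linearCombination k (BinTree.eval A.mul f) x) := by
      intro v t x
      have h0 : ∀ y, A.mul v y 0 = 0 := fun y => by simpa using A.mul_smul_right v 0 y 0
      induction x using Finsupp.induction_linear with
      | zero => simp [h0]
      | add p q hp hq => simp only [map_add, hp, hq, A.mul_add_right]
      | single s c => simp [preRight, BinTree.eval, A.mul_smul_right]
    change Finsupp.linearCombination k (BinTree.eval A.mul f) x = 0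
    induction hx with
    | add v w s t => simp [BinTree.eval, A.add_mul']
    | smul c v s t => simp [BinTree.eval, A.smul_mul']
    | swap v s t => simp [BinTree.eval, A.mul_swap]
    | left v t x _ ih =>
      rw [hl, ih]
      simpa using A.mul_smul_left v 0 0 (BinTree.eval A.mul f t)
    | right v s x _ ih =>
      rw [hr, ih]
      simpa using A.mul_smul_right v 0 (BinTree.eval A.mul f s) 0)

lemma lift_mk (A : GenAlgebra V B) (f : α → B) (t : BinTree V.carrier α) :
    lift A f (mk t) = t.eval A.mul f := by
  refine (Submodule.liftQ_apply _ _ _).trans ?_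
  simp

@[simp] lemma lift_X (A : GenAlgebra V B) (f : α → B) (a : α) : lift A f (X a) = f a :=
  lift_mk A f _

lemma lift_mul (A : GenAlgebra V B) (f : α → B) (v : V.carrier) (x y : Carrier V α) :
    lift A f (mul v x y) = A.mul v (lift A f x) (lift A f y) := by
  have h0 : ∀ y, A.mul v 0 y = 0 := fun y => by simpa using A.mul_smul_left v 0 0 y
  have h0' : ∀ y, A.mul v y 0 = 0 := fun y => by simpa using A.mul_smul_right v 0 y 0
  induction x using induction_mk with
  | h0 => simp [mul, alg, h0]
  | hadd p q hp hq =>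
    simp only [mul, (alg V α).mul_add_left, map_add, A.mul_add_left] at *
    rw [hp, hq]
  | hsmul c s =>
    simp only [mul, (alg V α).mul_smul_left, map_smul, A.mul_smul_left] at *
    congr 1
    induction y using induction_mk with
    | h0 => simp [alg, h0']
    | hadd p q hp hq =>
      simp only [(alg V α).mul_add_right, map_add, A.mul_add_right] at *
      rw [hp, hq]
    | hsmul c t =>
      simp only [(alg V α).mul_smul_right, map_smul, A.mul_smul_right] at *
      congr 1
      have := mul_mk v s t
      rw [mul] at this
      rw [this, lift_mk, lift_mk, lift_mk]
      rfl

/-- Morphisms of algebras which agree on generators are equal. -/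
lemma lift_unique (A : GenAlgebra V B) (g : Carrier V α →ₗ[k] B)
    (hg : ∀ v x y, g (mul v x y) = A.mul v (g x) (g y)) : g = lift A fun a => g (X a) := by
  refine hom_ext fun t => ?_
  rw [lift_mk]
  induction t with
  | leaf a => rfl
  | node v s t hs ht => rw [← mul_mk, hg, hs, ht]; rfl

end lift

/-- Substitution of elements for the labels of the leaves. -/
def subst (f : α → Carrier V β) : Carrier V α →ₗ[k] Carrier V β := lift (alg V β) f

@[simp] lemma subst_X (f : α → Carrier V β) (a : α) : subst f (X a) = f a := lift_X _ _ _

lemma subst_mul (f : α → Carrier V β) (v : V.carrier) (x y : Carrier V α) :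
    subst f (mul v x y) = mul v (subst f x) (subst f y) := lift_mul _ _ _ _ _

lemma subst_subst (f : α → Carrier V β) (g : β → Carrier V γ) (x : Carrier V α) :
    subst g (subst f x) = subst (fun a => subst g (f a)) x := by
  have h := lift_unique (alg V γ) ((subst g).comp (subst f)) (fun v x y => by
    simp only [LinearMap.comp_apply, subst_mul]; rfl)
  have := LinearMap.congr_fun h x
  simpa [subst] using this

lemma subst_X_eq (x : Carrier V α) : subst X x = x := by
  have h := lift_unique (alg V α) LinearMap.id (fun v x y => rfl)
  exact (LinearMap.congr_fun h x).symm

/-- Renaming of the labels of the leaves. -/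
def rename (f : α → β) : Carrier V α →ₗ[k] Carrier V β := subst fun a => X (f a)

@[simp] lemma rename_X (f : α → β) (a : α) : rename f (X a : Carrier V α) = X (f a) :=
  subst_X _ _

lemma rename_mul (f : α → β) (v : V.carrier) (x y : Carrier V α) :
    rename f (mul v x y) = mul v (rename f x) (rename f y) := subst_mul _ _ _ _

lemma subst_rename (f : α → β) (g : β → Carrier V γ) (x : Carrier V α) :
    subst g (rename f x) = subst (fun a => g (f a)) x := by
  simp [rename, subst_subst]

lemma rename_subst (f : α → Carrier V β) (g : β → γ) (x : Carrier V α) :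
    rename g (subst f x) = subst (fun a => rename g (f a)) x := by
  simp [rename, subst_subst]

lemma rename_rename (f : α → β) (g : β → γ) (x : Carrier V α) :
    rename g (rename f x) = rename (fun a => g (f a)) x := by
  simp [rename, subst_subst]

/-- The submodule spanned by the trees in which each label `a` occurs exactly `d a` times. -/
def degree (V : SymTwoModule k) [DecidableEq α] (d : α → ℕ) : Submodule k (Carrier V α) :=
  Submodule.span k {x | ∃ t : BinTree V.carrier α, (∀ a, t.occ a = d a) ∧ x = mk t}

lemma X_mem_degree [DecidableEq α] (a : α) :
    (X a : Carrier V α) ∈ degree V fun b => if a = b then 1 else 0 :=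
  Submodule.subset_span ⟨.leaf a, fun _ => rfl, rfl⟩

lemma mul_mem_degree [DecidableEq α] {d d' : α → ℕ} (v : V.carrier) {x y : Carrier V α}
    (hx : x ∈ degree V d) (hy : y ∈ degree V d') :
    mul v x y ∈ degree V fun a => d a + d' a := by
  change mulHom v x y ∈ _
  induction hx using Submodule.span_induction with
  | zero => simp
  | add _ _ _ _ h h' => rw [map_add]; exact add_mem h h'
  | smul c _ _ h => rw [map_smul]; exact Submodule.smul_mem _ c h
  | mem x hx =>
    obtain ⟨s, hs, rfl⟩ := hx
    induction hy using Submodule.span_induction with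
    | zero => simp
    | add _ _ _ _ h h' => rw [map_add]; exact add_mem h h'
    | smul c _ _ h => rw [map_smul]; exact Submodule.smul_mem _ c h
    | mem y hy =>
      obtain ⟨t, ht, rfl⟩ := hy
      rw [mulHom_mk]
      exact Submodule.subset_span ⟨_, fun a => by simp [BinTree.occ, hs, ht], rfl⟩

lemma subst_mem_degree [DecidableEq α] [DecidableEq β] [Fintype α] {d : α → ℕ}
    {d' : α → β → ℕ} {f : α → Carrier V β} (hf : ∀ a, f a ∈ degree V (d' a))
    {x : Carrier V α} (hx : x ∈ degree V d) :
    subst f x ∈ degree V fun b => ∑ a, d a * d' a b := by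
  induction hx using Submodule.span_induction with
  | zero => simp
  | add _ _ _ _ h h' => rw [map_add]; exact add_mem h h'
  | smul c _ _ h => rw [map_smul]; exact Submodule.smul_mem _ c h
  | mem x hx =>
    obtain ⟨t, ht, rfl⟩ := hx
    obtain rfl : (fun a => t.occ a) = d := funext ht
    clear ht
    induction t with
    | leaf a =>
      change subst f (X a) ∈ _
      rw [subst_X]
      convert hf a using 2
      simp [BinTree.occ]
    | node v s t hs ht =>
      rw [← mul_mk, subst_mul]
      convert mul_mem_degree v hs ht using 2
      simp [BinTree.occ, add_mul, Finset.sum_add_distrib]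

/-- The multilinear part `F(V)(n)`: the module of trees with `n` leaves, numbered by `1, …, n`
(here by `0, …, n - 1`) in some order. -/
def multilinear (V : SymTwoModule k) (n : ℕ) : Submodule k (Carrier V (Fin n)) :=
  degree V fun _ => 1

lemma rename_mem_multilinear {n : ℕ} (σ : Equiv.Perm (Fin n)) {x : Carrier V (Fin n)}
    (hx : x ∈ multilinear V n) : rename σ x ∈ multilinear V n := by
  have := subst_mem_degree (fun a => X_mem_degree (V := V) (σ a)) hx
  have h : (fun b => ∑ a, 1 * if σ a = b then 1 else 0) = fun _ : Fin n => 1 := by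
    funext b
    simp [← Equiv.eq_symm_apply]
  rw [h] at this
  exact this

lemma comp_mem_multilinear {m : ℕ} {n : Fin m → ℕ} {N : ℕ} (e : (Σ i, Fin (n i)) ≃ Fin N)
    {p : Carrier V (Fin m)} (hp : p ∈ multilinear V m) {q : ∀ i, Carrier V (Fin (n i))}
    (hq : ∀ i, q i ∈ multilinear V (n i)) :
    subst (fun i => rename (fun j => e ⟨i, j⟩) (q i)) p ∈ multilinear V N := by
  have := subst_mem_degree
    (fun i => subst_mem_degree (fun j => X_mem_degree (V := V) (e ⟨i, j⟩)) (hq i)) hp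
  have h : (fun b => ∑ i, 1 * ∑ j, 1 * if e ⟨i, j⟩ = b then 1 else 0) = fun _ : Fin N => 1 := by
    funext b
    simp only [one_mul]
    rw [← Fintype.sum_sigma' (fun i j => if e ⟨i, j⟩ = b then 1 else 0)]
    simp [← Equiv.eq_symm_apply]
  rw [h] at this
  exact this

section update

variable [DecidableEq α]

lemma eval_update_of_occ_eq_zero (t : BinTree V.carrier α) (a : α) (h : t.occ a = 0)
    (f : α → Carrier V β) (x : Carrier V β) :
    subst (Function.update f a x) (mk t) = subst f (mk t) := by
  induction t with
  | leaf b =>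
    change subst _ (X b) = subst _ (X b)
    have : b ≠ a := by simpa [BinTree.occ] using h
    simp [this]
  | node v s t hs ht =>
    simp only [BinTree.occ, Nat.add_eq_zero_iff] at h
    rw [← mul_mk, subst_mul, subst_mul, hs h.1, ht h.2]

lemma eval_update_add (t : BinTree V.carrier α) (a : α) (h : t.occ a = 1)
    (f : α → Carrier V β) (x y : Carrier V β) :
    subst (Function.update f a (x + y)) (mk t) =
      subst (Function.update f a x) (mk t) + subst (Function.update f a y) (mk t) := by
  induction t with
  | leaf b =>
    have : b = a := by simpa [BinTree.occ] using h
    subst this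
    change subst _ (X b) = subst _ (X b) + subst _ (X b)
    simp
  | node v s t hs ht =>
    simp only [← mul_mk, subst_mul]
    rcases Nat.add_eq_one_iff.1 h with ⟨h1, h2⟩ | ⟨h1, h2⟩
    · rw [ht h2]
      simp only [eval_update_of_occ_eq_zero s a h1]
      exact (alg V β).mul_add_right _ _ _ _
    · rw [hs h1]
      simp only [eval_update_of_occ_eq_zero t a h2]
      exact (alg V β).mul_add_left _ _ _ _

lemma eval_update_smul (t : BinTree V.carrier α) (a : α) (h : t.occ a = 1)
    (f : α → Carrier V β) (c : k) (x : Carrier V β) :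
    subst (Function.update f a (c • x)) (mk t) = c • subst (Function.update f a x) (mk t) := by
  induction t with
  | leaf b =>
    have : b = a := by simpa [BinTree.occ] using h
    subst this
    change subst _ (X b) = c • subst _ (X b)
    simp
  | node v s t hs ht =>
    simp only [← mul_mk, subst_mul]
    rcases Nat.add_eq_one_iff.1 h with ⟨h1, h2⟩ | ⟨h1, h2⟩
    · rw [ht h2]
      simp only [eval_update_of_occ_eq_zero s a h1]
      exact (alg V β).mul_smul_right _ _ _ _
    · rw [hs h1]
      simp only [eval_update_of_occ_eq_zero t a h2]
      exact (alg V β).mul_smul_left _ _ _ _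

lemma subst_update_add {n : ℕ} {p : Carrier V (Fin n)} (hp : p ∈ multilinear V n) (a : Fin n)
    (f : Fin n → Carrier V β) (x y : Carrier V β) :
    subst (Function.update f a (x + y)) p =
      subst (Function.update f a x) p + subst (Function.update f a y) p := by
  induction hp using Submodule.span_induction with
  | zero => simp
  | add _ _ _ _ h h' => simp only [map_add, h, h']; abel
  | smul c _ _ h => simp only [map_smul, h, smul_add]
  | mem x hx =>
    obtain ⟨t, ht, rfl⟩ := hx
    exact eval_update_add t a (ht a) f _ _

lemma subst_update_smul {n : ℕ} {p : Carrier V (Fin n)} (hp : p ∈ multilinear V n) (a : Fin n)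
    (f : Fin n → Carrier V β) (c : k) (x : Carrier V β) :
    subst (Function.update f a (c • x)) p = c • subst (Function.update f a x) p := by
  induction hp using Submodule.span_induction with
  | zero => simp
  | add _ _ _ _ h h' => simp only [map_add, h, h', smul_add]
  | smul c' _ _ h => simp only [map_smul, h, smul_comm c c']
  | mem x hx =>
    obtain ⟨t, ht, rfl⟩ := hx
    exact eval_update_smul t a (ht a) f _ _

end update

lemma multilinear_zero (V : SymTwoModule k) : multilinear V 0 = ⊥ := by
  refine Submodule.span_eq_bot.2 ?_
  rintro x ⟨t, -, -⟩
  exfalso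
  induction t with
  | leaf a => exact a.elim0
  | node v s t hs ht => exact hs

end FreeGen

open FreeGen in
/-- The free operad `F(V)` on a `k[𝕊_2]`-module `V`: composition is grafting of trees. -/
def freeOperad {k : Type u} [CommRing k] (V : SymTwoModule k) : Operad k where
  obj n := multilinear V n
  addCommGroup n := inferInstance
  module n := inferInstance
  subsingleton_zero := by rw [multilinear_zero]; infer_instance
  act σ := (rename σ.symm).restrict fun _ hx => rename_mem_multilinear σ.symm hx
  act_one p := Subtype.ext (subst_X_eq p.1)
  act_mul σ τ p := Subtype.ext (rename_rename σ.symm τ.symm p.1).symm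
  one := ⟨X 0, by
    have h : (fun b : Fin 1 => if 0 = b then 1 else 0) = fun _ => 1 := by
      funext b
      simp [Subsingleton.elim b 0]
    have := X_mem_degree (V := V) (0 : Fin 1)
    rw [h] at this
    exact this⟩
  comp e p q := ⟨subst (fun i => rename (fun j => e ⟨i, j⟩) (q i).1) p.1,
    comp_mem_multilinear e p.2 fun i => (q i).2⟩
  comp_add_left e p p' q := Subtype.ext (map_add _ _ _)
  comp_smul_left e c p q := Subtype.ext (map_smul _ _ _)
  comp_update_add {m n N} e p q i x y := by
    have h : ∀ z : multilinear V (n i),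
        (fun i' => rename (fun j => e ⟨i', j⟩) (Function.update q i z i').1) =
        Function.update (fun i' => rename (fun j => e ⟨i', j⟩) (q i').1) i
          (rename (fun j => e ⟨i, j⟩) z.1) := fun z => funext fun i' =>
      Function.apply_update (fun i' (z : multilinear V (n i')) =>
        rename (fun j => e ⟨i', j⟩) z.1) q i z i'
    refine Subtype.ext ?_
    simp only [h, Submodule.coe_add, map_add, subst_update_add p.2]
  comp_update_smul {m n N} e p q i c x := by
    have h : ∀ z : multilinear V (n i),
        (fun i' => rename (fun j => e ⟨i', j⟩) (Function.update q i z i').1) =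
        Function.update (fun i' => rename (fun j => e ⟨i', j⟩) (q i').1) i
          (rename (fun j => e ⟨i, j⟩) z.1) := fun z => funext fun i' =>
      Function.apply_update (fun i' (z : multilinear V (n i')) =>
        rename (fun j => e ⟨i', j⟩) z.1) q i z i'
    refine Subtype.ext ?_
    simp only [h, Submodule.coe_smul, map_smul, subst_update_smul p.2]
  act_comp e σ p q := Subtype.ext (by
    simp [rename_subst, rename_rename])
  comp_act_right e σ p q := Subtype.ext (by
    simp [rename_rename])
  comp_act_left e ν p q := Subtype.ext (by
    simp [subst_rename, Equiv.sigmaCongrLeft])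
  one_comp p := Subtype.ext (by
    simp only [subst_X]
    exact subst_X_eq p.1)
  comp_one p := Subtype.ext (by
    simp [subst_X_eq])
  assoc {m n l L M N} c d e p q r := Subtype.ext (by
    let F : (Σ i, Fin (n i)) → Carrier V (Fin N) := fun x =>
      rename (fun y => e ⟨x.1, d x.1 ⟨x.2, y⟩⟩) (r x.1 x.2).1
    have h : ∀ i j, F (c.symm (c ⟨i, j⟩)) = F ⟨i, j⟩ := fun i j => by
      rw [Equiv.symm_apply_apply]
    simp only [rename_subst, rename_rename, subst_subst, subst_rename]
    change subst (fun i => subst (fun j => F ⟨i, j⟩) (q i).1) p.1 =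
      subst (fun i => subst (fun j => F (c.symm (c ⟨i, j⟩))) (q i).1) p.1
    simp only [h])

namespace FreeGen

variable {k : Type u} [CommRing k] {V W : SymTwoModule k} {α : Type}

/-- The generator `v(1, 2)` of the free operad. -/
def genOp (v : V.carrier) : (freeOperad V).obj 2 :=
  ⟨mul v (X 0) (X 1), by
    have h : (fun b : Fin 2 => (if 0 = b then 1 else 0) + if 1 = b then 1 else 0) =
        fun _ => 1 := by decide
    have := mul_mem_degree v (X_mem_degree (V := V) (0 : Fin 2)) (X_mem_degree (1 : Fin 2))
    rw [h] at this
    exact this⟩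

/-- The map on trees induced by an isomorphism of generators. -/
def mapGen (φ : V.Iso W) : Carrier V α →ₗ[k] Carrier W α :=
  lift
    { mul := fun v x y => (alg W α).mul (φ.equiv v) x y
      add_mul' := fun v w x y => by rw [map_add, (alg W α).add_mul']
      smul_mul' := fun c v x y => by rw [map_smul, (alg W α).smul_mul']
      mul_add_left := fun v => (alg W α).mul_add_left _
      mul_smul_left := fun v => (alg W α).mul_smul_left _
      mul_add_right := fun v => (alg W α).mul_add_right _
      mul_smul_right := fun v => (alg W α).mul_smul_right _
      mul_swap := fun v x y => by rw [φ.map_swap, (alg W α).mul_swap] } X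

lemma mapGen_X (φ : V.Iso W) (a : α) : mapGen φ (X a) = X a := lift_X _ _ _

lemma mapGen_mul (φ : V.Iso W) (v : V.carrier) (x y : Carrier V α) :
    mapGen φ (mul v x y) = mul (φ.equiv v) (mapGen φ x) (mapGen φ y) := lift_mul _ _ _ _ _

lemma mapGen_mem_degree [DecidableEq α] (φ : V.Iso W) {d : α → ℕ} {x : Carrier V α}
    (hx : x ∈ degree V d) : mapGen φ x ∈ degree W d := by
  induction hx using Submodule.span_induction with
  | zero => simp
  | add _ _ _ _ h h' => rw [map_add]; exact add_mem h h'
  | smul c _ _ h => rw [map_smul]; exact Submodule.smul_mem _ c h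
  | mem x hx =>
    obtain ⟨t, ht, rfl⟩ := hx
    obtain rfl : (fun a => t.occ a) = d := funext ht
    clear ht
    induction t with
    | leaf a =>
      change mapGen φ (X a) ∈ _
      rw [mapGen_X]
      exact X_mem_degree (V := W) a
    | node v s t hs ht =>
      rw [← mul_mk, mapGen_mul]
      exact mul_mem_degree _ hs ht

/-- The isomorphism of generators `φ : V ≅ W` induces `F(φ)(n) : F(V)(n) → F(W)(n)`. -/
def mapFree (φ : V.Iso W) (n : ℕ) : (freeOperad V).obj n →ₗ[k] (freeOperad W).obj n :=
  (mapGen φ).restrict fun _ hx => mapGen_mem_degree φ hx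

/-! ### The pairing between `F(V^∨)(3)` and `F(V)(3)` -/

/-- The algebra which records the coefficients of the trees with at most three leaves; trees with
more leaves are sent to zero. -/
def coefAlg (V : SymTwoModule k) (α : Type) : GenAlgebra V
    ((α → k) × (α → α → V.carrier) × (α → α → α → V.carrier ⊗[k] V.carrier)) where
  mul v x y := (0, fun a b => (x.1 a * y.1 b) • v + (y.1 a * x.1 b) • V.swap v,
    fun a b c => y.1 c • (v ⊗ₜ[k] x.2.1 a b) + x.1 c • (V.swap v ⊗ₜ[k] y.2.1 a b))
  add_mul' v w x y := by
    ext <;> simp [TensorProduct.add_tmul] <;> abel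
  smul_mul' c v x y := by
    ext <;> simp [TensorProduct.smul_tmul', smul_comm c]
  mul_add_left v x x' y := by
    ext <;> simp [TensorProduct.tmul_add, add_mul, mul_add, add_smul] <;> abel
  mul_smul_left v c x y := by
    ext <;> simp [mul_smul, smul_comm _ c]
  mul_add_right v x y y' := by
    ext <;> simp [TensorProduct.tmul_add, add_mul, mul_add, add_smul] <;> abel
  mul_smul_right v c x y := by
    ext <;> simp [mul_smul, smul_comm _ c]
  mul_swap v x y := by
    ext <;> simp [V.swap_swap, add_comm, mul_comm]

/-- All the coefficients of an element. -/
def coefs : Carrier V α →ₗ[k]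
    (α → k) × (α → α → V.carrier) × (α → α → α → V.carrier ⊗[k] V.carrier) :=
  open Classical in
  lift (coefAlg V α) fun a => (Pi.single a 1, 0, 0)

/-- The coefficient in `V ⊗ V` of the trees of the shape `((a b) c)`: for pairwise distinct
`a, b, c`, the tree `v(w(a, b), c)` has the coefficient `v ⊗ w`, and the other representatives of
the same tree, such as `v(w(b, a), c)` or `v(c, w(a, b))`, have the coefficients `v ⊗ w·(12)`,
`v·(12) ⊗ w` obtained by rewriting them in this form. -/
def coef (a b c : α) : Carrier V α →ₗ[k] V.carrier ⊗[k] V.carrier :=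
  LinearMap.proj c ∘ₗ LinearMap.proj b ∘ₗ LinearMap.proj a ∘ₗ
    LinearMap.snd k _ _ ∘ₗ LinearMap.snd k _ _ ∘ₗ coefs

/-- The pairing `F(V^∨)(3) ⊗ F(V)(3) → k`.  As a module, `F(V)(3)` is the sum of three copies of
`V ⊗ V`, one for each of the shapes `((1 2) 3)`, `((2 3) 1)`, `((3 1) 2)`, on which the pairing is
the evaluation of `V^∨ ⊗ V^∨` on `V ⊗ V`. -/
def pairing (V : SymTwoModule k) :
    (freeOperad V.czechDual).obj 3 →ₗ[k] (freeOperad V).obj 3 →ₗ[k] k :=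
  ∑ c : Fin 3, (TensorProduct.dualDistrib k V.carrier V.carrier).compl₁₂
    ((coef (V := V.czechDual) (c + 1) (c + 2) c).comp (multilinear V.czechDual 3).subtype)
    ((coef (c + 1) (c + 2) c).comp (multilinear V 3).subtype)

lemma coefs_X [DecidableEq α] (a : α) :
    coefs (X a : Carrier V α) = (Pi.single a 1, 0, 0) := by
  rw [coefs, lift_X]
  congr!

lemma coefs_mul (v : V.carrier) (x y : Carrier V α) :
    coefs (mul v x y) = (coefAlg V α).mul v (coefs x) (coefs y) := lift_mul _ _ _ _ _

lemma coefs_rename (σ : Equiv.Perm α) (x : Carrier V α) :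
    coefs (rename σ x) = (fun a => (coefs x).1 (σ.symm a),
      fun a b => (coefs x).2.1 (σ.symm a) (σ.symm b),
      fun a b c => (coefs x).2.2 (σ.symm a) (σ.symm b) (σ.symm c)) := by
  classical
  induction x using induction_mk with
  | h0 => simp; rfl
  | hadd x y hx hy => rw [map_add, map_add, hx, hy, map_add]; rfl
  | hsmul c t =>
    rw [map_smul, map_smul, map_smul]
    suffices h : coefs (rename σ (mk t : Carrier V α)) = (fun a => (coefs (mk t)).1 (σ.symm a),
      fun a b => (coefs (mk t)).2.1 (σ.symm a) (σ.symm b),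
      fun a b c => (coefs (mk t)).2.2 (σ.symm a) (σ.symm b) (σ.symm c)) by
      rw [h]; rfl
    induction t with
    | leaf a =>
      change coefs (rename σ (X a)) = (fun a' => (coefs (X a)).1 (σ.symm a'),
        fun b c => (coefs (X a)).2.1 (σ.symm b) (σ.symm c),
        fun b c d => (coefs (X a)).2.2 (σ.symm b) (σ.symm c) (σ.symm d))
      rw [rename_X, coefs_X, coefs_X]
      refine Prod.ext (funext fun b => ?_) rfl
      simp [Pi.single_apply, Equiv.symm_apply_eq]
    | node v s t hs ht =>
      rw [← mul_mk, rename_mul, coefs_mul, coefs_mul, hs, ht]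
      rfl

lemma coef_rename (σ : Equiv.Perm α) (a b c : α) (x : Carrier V α) :
    coef a b c (rename σ x) = coef (σ.symm a) (σ.symm b) (σ.symm c) x := by
  simp [coef, coefs_rename]

lemma coef_swap (a b c : α) (x : Carrier V α) :
    coef b a c x = TensorProduct.map LinearMap.id V.swap (coef a b c x) := by
  classical
  suffices h : (∀ a b, (coefs x).2.1 b a = V.swap ((coefs x).2.1 a b)) ∧ ∀ a b c,
      (coefs x).2.2 b a c = TensorProduct.map LinearMap.id V.swap ((coefs x).2.2 a b c) from
    h.2 a b c
  induction x using induction_mk with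
  | h0 => simp
  | hadd x y hx hy =>
    exact ⟨fun a b => by simp [hx.1 a b, hy.1 a b], fun a b c => by simp [hx.2 a b c, hy.2 a b c]⟩
  | hsmul c t =>
    suffices h : (∀ a b, (coefs (mk t)).2.1 b a = V.swap ((coefs (mk t)).2.1 a b)) ∧ ∀ a b c,
        (coefs (mk t)).2.2 b a c =
          TensorProduct.map LinearMap.id V.swap ((coefs (mk t)).2.2 a b c) by
      exact ⟨fun a b => by simp [h.1 a b], fun a b c => by simp [h.2 a b c]⟩
    induction t with
    | leaf a =>
      change (∀ b c, (coefs (X a)).2.1 c b = V.swap ((coefs (X a)).2.1 b c)) ∧ ∀ b c d,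
        (coefs (X a)).2.2 c b d =
          TensorProduct.map LinearMap.id V.swap ((coefs (X a)).2.2 b c d)
      simp [coefs_X]
    | node v s t hs ht =>
      rw [← mul_mk, coefs_mul]
      refine ⟨fun a b => ?_, fun a b c => ?_⟩
      · simp [coefAlg, V.swap_swap, add_comm, mul_comm]
      · simp [coefAlg, hs.1 a b, ht.1 a b]

lemma dualDistrib_swap (f : V.czechDual.carrier ⊗[k] V.czechDual.carrier)
    (x : V.carrier ⊗[k] V.carrier) :
    TensorProduct.dualDistrib k V.carrier V.carrier
      (TensorProduct.map LinearMap.id V.czechDual.swap f)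
      (TensorProduct.map LinearMap.id V.swap x) =
    - TensorProduct.dualDistrib k V.carrier V.carrier f x := by
  induction f using TensorProduct.induction_on with
  | zero => simp
  | add f g hf hg => simp only [map_add, LinearMap.add_apply, hf, hg, neg_add]
  | tmul f g =>
    induction x using TensorProduct.induction_on with
    | zero => simp
    | add x y hx hy => simp only [map_add, hx, hy, neg_add]
    | tmul x y => simp [Module.Dual.transpose_apply, V.swap_swap]

lemma pairing_apply (φ : (freeOperad V.czechDual).obj 3) (x : (freeOperad V).obj 3) :
    pairing V φ x = ∑ c : Fin 3, TensorProduct.dualDistrib k V.carrier V.carrier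
      (coef (V := V.czechDual) (c + 1) (c + 2) c φ.1) (coef (c + 1) (c + 2) c x.1) := by
  simp only [pairing, LinearMap.sum_apply]
  rfl

lemma sum_dualDistrib_rename (σ : Equiv.Perm (Fin 3)) (φ : Carrier V.czechDual (Fin 3))
    (x : Carrier V (Fin 3)) :
    ∑ c : Fin 3, TensorProduct.dualDistrib k V.carrier V.carrier
      (coef (V := V.czechDual) (c + 1) (c + 2) c (rename (V := V.czechDual) σ.symm φ))
      (coef (c + 1) (c + 2) c (rename σ.symm x)) =
    ((Equiv.Perm.sign σ : ℤ) : k) * ∑ c : Fin 3, TensorProduct.dualDistrib k V.carrier V.carrier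
      (coef (V := V.czechDual) (c + 1) (c + 2) c φ) (coef (c + 1) (c + 2) c x) := by
  have hσ : (Equiv.Perm.sign σ = 1 ∧ ∀ c, σ (c + 1) = σ c + 1 ∧ σ (c + 2) = σ c + 2) ∨
      (Equiv.Perm.sign σ = -1 ∧ ∀ c, σ (c + 1) = σ c + 2 ∧ σ (c + 2) = σ c + 1) := by
    revert σ; decide
  rw [← Equiv.sum_comp σ (fun c => TensorProduct.dualDistrib k V.carrier V.carrier
    (coef (V := V.czechDual) (c + 1) (c + 2) c φ) (coef (c + 1) (c + 2) c x)), Finset.mul_sum]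
  refine Finset.sum_congr rfl fun c _ => ?_
  rw [coef_rename (V := V.czechDual), coef_rename (V := V), Equiv.symm_symm]
  rcases hσ with ⟨h1, h2⟩ | ⟨h1, h2⟩
  · rw [h1, (h2 c).1, (h2 c).2]
    simp
  · rw [h1, (h2 c).1, (h2 c).2, coef_swap (V := V.czechDual) (σ c + 1), coef_swap (σ c + 1),
      dualDistrib_swap]
    simp

/-- The pairing is equivariant up to the signature. -/
lemma pairing_act (σ : Equiv.Perm (Fin 3)) (φ : (freeOperad V.czechDual).obj 3)
    (x : (freeOperad V).obj 3) :
    pairing V ((freeOperad V.czechDual).act σ φ) ((freeOperad V).act σ x) =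
      ((Equiv.Perm.sign σ : ℤ) : k) * pairing V φ x := by
  rw [pairing_apply, pairing_apply]
  exact sum_dualDistrib_rename σ φ.1 x.1

end FreeGen

/-! ### Binary quadratic operads and their Koszul duals -/

/-- Binary quadratic data: a `k[𝕊_2]`-module `V` of generating operations and an `𝕊_3`-submodule
`R` of relations in `F(V)(3)`, which is the weight two part `F_{(2)}(V)` of the free operad since
all generators are binary. -/
structure QuadraticData (k : Type u) [CommRing k] where
  gen : SymTwoModule k
  rel : Submodule k ((freeOperad gen).obj 3)
  act_mem : ∀ (σ : Equiv.Perm (Fin 3)) (x : (freeOperad gen).obj 3),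
    x ∈ rel → (freeOperad gen).act σ x ∈ rel

namespace QuadraticData

variable {k : Type u} [CommRing k]

/-- The relations as a family of sets of operations of the free operad. -/
def relFamily (D : QuadraticData k) : ∀ n, Set ((freeOperad D.gen).obj n)
  | 3 => D.rel
  | _ => ∅

/-- The quadratic operad `F(V)/(R)`. -/
def operad (D : QuadraticData k) : Operad k :=
  (freeOperad D.gen).quotient (Operad.Ideal.span (freeOperad D.gen) D.relFamily)

/-- The class in `F(V)/(R)` of a generating operation. -/
def op (D : QuadraticData k) (v : D.gen.carrier) : D.operad.obj 2 :=
  Submodule.Quotient.mk (FreeGen.genOp v)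

/-- The Koszul dual data `(V^∨, R^⊥)`; the Koszul dual operad of `F(V)/(R)` is
`F(V^∨)/(R^⊥)`. -/
def koszulDual (D : QuadraticData k) : QuadraticData k where
  gen := D.gen.czechDual
  rel :=
    { carrier := {φ | ∀ r ∈ D.rel, FreeGen.pairing D.gen φ r = 0}
      add_mem' := fun {φ ψ} hφ hψ r hr => by
        rw [map_add, LinearMap.add_apply, hφ r hr, hψ r hr, add_zero]
      zero_mem' := fun r _ => by rw [map_zero, LinearMap.zero_apply]
      smul_mem' := fun c φ hφ r hr => by
        rw [map_smul, LinearMap.smul_apply, hφ r hr, smul_zero] }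
  act_mem σ φ hφ r hr := by
    have h := FreeGen.pairing_act σ φ ((freeOperad D.gen).act σ⁻¹ r)
    rw [← (freeOperad D.gen).act_mul, inv_mul_cancel, (freeOperad D.gen).act_one,
      hφ _ (D.act_mem _ _ hr), mul_zero] at h
    exact h

end QuadraticData

open FreeGen in
/-- The `𝕊_3`-submodule of `F(V)(3)` generated by relators: the span of all the relators
`r ∈ rel x y z`, for all the numberings `x, y, z` of the three inputs. -/
def relatorSpan {k : Type u} [CommRing k] {V : SymTwoModule k}
    (rel : Carrier V (Fin 3) → Carrier V (Fin 3) → Carrier V (Fin 3) → Set (Carrier V (Fin 3))) :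
    Submodule k ((freeOperad V).obj 3) :=
  (Submodule.span k {r | ∃ σ : Equiv.Perm (Fin 3), r ∈ rel (X (σ 0)) (X (σ 1)) (X (σ 2))}).comap
    (multilinear V 3).subtype

open FreeGen in
lemma relatorSpan_act_mem {k : Type u} [CommRing k] {V : SymTwoModule k}
    (rel : Carrier V (Fin 3) → Carrier V (Fin 3) → Carrier V (Fin 3) → Set (Carrier V (Fin 3)))
    (h : ∀ (σ : Equiv.Perm (Fin 3)) (x y z r), r ∈ rel x y z →
      rename σ r ∈ rel (rename σ x) (rename σ y) (rename σ z))
    (σ : Equiv.Perm (Fin 3)) (r : (freeOperad V).obj 3) (hr : r ∈ relatorSpan rel) :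
    (freeOperad V).act σ r ∈ relatorSpan rel := by
  have key : ∀ r ∈ Submodule.span k
      {r | ∃ σ : Equiv.Perm (Fin 3), r ∈ rel (X (σ 0)) (X (σ 1)) (X (σ 2))},
      rename σ.symm r ∈ Submodule.span k
        {r | ∃ σ : Equiv.Perm (Fin 3), r ∈ rel (X (σ 0)) (X (σ 1)) (X (σ 2))} := by
    intro r hr
    induction hr using Submodule.span_induction with
    | zero => simp
    | add _ _ _ _ h h' => rw [map_add]; exact add_mem h h'
    | smul c _ _ h => rw [map_smul]; exact Submodule.smul_mem _ c h
    | mem r hr =>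
      obtain ⟨ρ, hρ⟩ := hr
      refine Submodule.subset_span ⟨ρ.trans σ.symm, ?_⟩
      have := h σ.symm _ _ _ _ hρ
      simpa using this
  exact key r.1 hr

/-! ### The operad `ComTrias` -/

section ComTrias

open FreeGen

variable (k : Type u) [CommRing k]

/-- The generators `V = *.k[𝕊_2] ⊕ •.k`; the element `((a, b), c)` is `a * + b *·(12) + c •`. -/
abbrev comTriasGen : SymTwoModule k where
  carrier := (k × k) × k
  swap := LinearMap.prodMap (LinearEquiv.prodComm k k k).toLinearMap LinearMap.id
  swap_swap _ := rfl

/-- The operation `*`. -/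
def comTriasStar : (comTriasGen k).carrier := ((1, 0), 0)

/-- The operation `•`. -/
def comTriasBullet : (comTriasGen k).carrier := ((0, 0), 1)

variable {k}

/-- The relations of commutative trialgebras (the commutativity of `•` is part of the definition
of the generators). -/
def comTriasRelators {α : Type} (x y z : Carrier (comTriasGen k) α) :
    Set (Carrier (comTriasGen k) α) :=
  let s := mul (α := α) (comTriasStar k)
  let b := mul (α := α) (comTriasBullet k)
  { s (s x y) z - s x (s y z),
    s x (s y z) - s x (s z y),
    b (b x y) z - b x (b y z),
    s x (b y z) - s x (s y z),
    s (b x y) z - b x (s y z) }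

variable (k)

/-- The quadratic presentation of the operad coding commutative trialgebras. -/
def comTrias : QuadraticData k where
  gen := comTriasGen k
  rel := relatorSpan comTriasRelators
  act_mem := relatorSpan_act_mem _ fun σ x y z r hr => by
    simp only [comTriasRelators, Set.mem_insert_iff, Set.mem_singleton_iff] at hr ⊢
    rcases hr with rfl | rfl | rfl | rfl | rfl <;> simp [rename_mul]

end ComTrias

/-! ### The operad `PostLie` -/

section PostLie

open FreeGen

variable (k : Type u) [CommRing k]

/-- The generators `W = ∘.k[𝕊_2] ⊕ [,].sgn`; the element `((a, b), c)` is
`a ∘ + b ∘·(12) + c [,]`. -/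
abbrev postLieGen : SymTwoModule k where
  carrier := (k × k) × k
  swap := LinearMap.prodMap (LinearEquiv.prodComm k k k).toLinearMap (-LinearMap.id)
  swap_swap v := by ext <;> simp

/-- The operation `∘`. -/
def postLieCirc : (postLieGen k).carrier := ((1, 0), 0)

/-- The operation `[,]`. -/
def postLieBracket : (postLieGen k).carrier := ((0, 0), 1)

variable {k}

/-- The relations of PostLie algebras (the antisymmetry of `[,]` is part of the definition of the
generators). -/
def postLieRelators {α : Type} (x y z : Carrier (postLieGen k) α) :
    Set (Carrier (postLieGen k) α) :=
  let o := mul (α := α) (postLieCirc k)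
  let b := mul (α := α) (postLieBracket k)
  { b x (b y z) + b y (b z x) + b z (b x y),
    o (o x y) z - o x (o y z) - o (o x z) y + o x (o z y) - o x (b y z),
    o (b x y) z - (b (o x z) y + b x (o y z)) }

variable (k)

/-- The quadratic presentation of the operad coding PostLie algebras. -/
def postLie : QuadraticData k where
  gen := postLieGen k
  rel := relatorSpan postLieRelators
  act_mem := relatorSpan_act_mem _ fun σ x y z r hr => by
    simp only [postLieRelators, Set.mem_insert_iff, Set.mem_singleton_iff] at hr ⊢
    rcases hr with rfl | rfl | rfl <;> simp [rename_mul]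

end PostLie

/-! ### The identification of the generators -/

section Identification

variable (k : Type u) [CommRing k]

/-- The linear form on the generators of `ComTrias` dual to `*` (in the basis `*`, `*·(12)`,
`•`). -/
def dualStar : (comTrias k).koszulDual.gen.carrier :=
  (LinearMap.fst k k k ∘ₗ LinearMap.fst k (k × k) k : (k × k) × k →ₗ[k] k)

/-- The linear form on the generators of `ComTrias` dual to `•`. -/
def dualBullet : (comTrias k).koszulDual.gen.carrier :=
  (LinearMap.snd k (k × k) k : (k × k) × k →ₗ[k] k)

end Identification

end

/-!
The free operad in arity three is the sum of three copies of `V ⊗ V`, one for each leaf adjacent to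
the root (`weightTwoEquiv`), so that a basis of `V` indexed by `ι` gives a basis of `F(V)(3)`
indexed by `Fin 3 × ι × ι` (`treeBasis`), and dual bases of `V` and `V^∨` give dual bases for the
pairing (`pairing_treeBasis`).

In the basis `*`, `*·(12)`, `•`, all the relations of `ComTrias` are equalities between two trees.
To a tree one can attach the set of inputs which it multiplies: `x * y` keeps the inputs of `x`
only, while `x • y` keeps those of `x` and `y`.  The relations identify two trees exactly when
these sets agree (`comTrias_rel`).  Hence `R` is spanned by the differences of trees along the
fibres of a surjection `support` from `27` trees onto the `7` nonempty subsets of `{0, 1, 2}`.  It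
has rank `27 - 7 = 20`, and its orthogonal has the basis of the sums of dual trees over the seven
fibres (`finrank_fiberDiff`, `mem_span_fiberSum_iff`).

The dual of the basis `*`, `*·(12)`, `•` corresponds to the basis `∘`, `-∘·(12)`, `[,]` of `W`, the
sign coming from the twist by `sgn`.  Under this identification the seven sums over fibres are, up
to sign, the relators of `PostLie` (`postLieRelators_cyclic`): the fibres over the singletons, which
have five elements, give the relation between `∘` and `[,]` with five terms, the fibres over the
pairs give the three derivation relations, and the fibre over `{0, 1, 2}` gives the Jacobi identity.
Thus `R^⊥` is carried onto `S` (`postLie_rel`, `map_koszulDual_rel`).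

Finally an isomorphism of generators extends to the free operads, and if it matches the relations it
matches the ideals which they generate and descends to the quotients
(`QuadraticData.exists_operadIso`).
-/

/-! ### Isomorphisms of operads and ideals -/

namespace Operad

variable {k : Type u} [CommRing k] {P Q : Operad k}

/-- The inverse of an isomorphism of operads. -/
def Iso.symm (F : Operad.Iso P Q) : Operad.Iso Q P where
  equiv n := (F.equiv n).symm
  map_act σ p := by
    rw [LinearEquiv.symm_apply_eq, F.map_act, LinearEquiv.apply_symm_apply]
  map_one := by rw [LinearEquiv.symm_apply_eq, F.map_one]
  map_comp e p q := by
    rw [LinearEquiv.symm_apply_eq, F.map_comp]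
    simp only [LinearEquiv.apply_symm_apply]

/-- The preimage of an operadic ideal under an isomorphism of operads. -/
def Ideal.comap (F : Operad.Iso P Q) (J : Q.Ideal) : P.Ideal where
  carrier n := (J.carrier n).comap (F.equiv n).toLinearMap
  act_mem σ p hp := by
    simp only [Submodule.mem_comap, LinearEquiv.coe_coe, F.map_act] at hp ⊢
    exact J.act_mem σ _ hp
  comp_mem_left e p q hp := by
    simp only [Submodule.mem_comap, LinearEquiv.coe_coe, F.map_comp] at hp ⊢
    exact J.comp_mem_left e _ _ hp
  comp_mem_right e p q i hq := by
    simp only [Submodule.mem_comap, LinearEquiv.coe_coe, F.map_comp] at hq ⊢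
    exact J.comp_mem_right e _ _ i hq

lemma Ideal.subset_span (R : ∀ n, Set (P.obj n)) (n : ℕ) :
    R n ⊆ (Ideal.span P R).carrier n := fun x hx => by
  simp only [Ideal.span, SetLike.mem_coe, Submodule.mem_iInf]
  exact fun J hJ => hJ n hx

lemma Ideal.span_le {R : ∀ n, Set (P.obj n)} {J : P.Ideal} (h : ∀ n, R n ⊆ J.carrier n) (n : ℕ) :
    (Ideal.span P R).carrier n ≤ J.carrier n :=
  iInf₂_le J h

lemma Ideal.span_le_comap (F : Operad.Iso P Q) {R : ∀ n, Set (P.obj n)} {S : ∀ n, Set (Q.obj n)}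
    (h : ∀ n, ∀ x ∈ R n, F.equiv n x ∈ S n) (n : ℕ) (x : P.obj n)
    (hx : x ∈ (Ideal.span P R).carrier n) : F.equiv n x ∈ (Ideal.span Q S).carrier n :=
  Ideal.span_le (J := (Ideal.span Q S).comap F)
    (fun m y hy => Ideal.subset_span S m (h m y hy)) n hx

/-- An isomorphism carrying generators of an ideal onto generators of an ideal carries the first
ideal onto the second one: both inclusions follow from the minimality of the generated ideal. -/
lemma Ideal.map_span (F : Operad.Iso P Q) {R : ∀ n, Set (P.obj n)} {S : ∀ n, Set (Q.obj n)}
    (h : ∀ n, F.equiv n '' R n = S n) (n : ℕ) :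
    ((Ideal.span P R).carrier n).map (F.equiv n).toLinearMap = (Ideal.span Q S).carrier n := by
  refine le_antisymm ?_ fun y hy => ⟨F.symm.equiv n y, ?_, (F.equiv n).apply_symm_apply y⟩
  · rintro _ ⟨x, hx, rfl⟩
    exact Ideal.span_le_comap F (fun m x hx => h m ▸ Set.mem_image_of_mem _ hx) n x hx
  · refine Ideal.span_le_comap F.symm (fun m z hz => ?_) n y hy
    obtain ⟨x, hx, rfl⟩ := (h m).symm ▸ hz
    simpa [Iso.symm] using hx

/-- An isomorphism of operads which carries an ideal onto another one induces an isomorphism of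
the quotient operads. -/
def Iso.quotient (F : Operad.Iso P Q) (I : P.Ideal) (J : Q.Ideal)
    (h : ∀ n, (I.carrier n).map (F.equiv n).toLinearMap = J.carrier n) :
    Operad.Iso (P.quotient I) (Q.quotient J) where
  equiv n := Submodule.Quotient.equiv _ _ (F.equiv n) (h n)
  map_act σ p := by
    obtain ⟨p, rfl⟩ := Submodule.Quotient.mk_surjective _ p
    exact congrArg Submodule.Quotient.mk (F.map_act σ p)
  map_one := congrArg Submodule.Quotient.mk F.map_one
  map_comp {m n N} e p q := by
    obtain ⟨p, rfl⟩ := Submodule.Quotient.mk_surjective _ p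
    obtain ⟨q, rfl⟩ := I.exists_rep q
    refine (congrArg (Submodule.Quotient.equiv _ _ (F.equiv N) (h N))
      (I.quotComp_mk e p q)).trans ?_
    exact (congrArg Submodule.Quotient.mk (F.map_comp e p q)).trans (J.quotComp_mk e _ _).symm

end Operad

/-! ### Functoriality of the free operad -/

namespace FreeGen

section Functoriality

variable {k : Type u} [CommRing k] {V W : SymTwoModule k} {α β : Type}

lemma mapGen_subst (φ : V.Iso W) (f : α → Carrier V β) (x : Carrier V α) :
    mapGen φ (subst f x) = subst (fun a => mapGen φ (f a)) (mapGen φ x) := by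
  suffices h : mapGen φ ∘ₗ subst f = subst (fun a => mapGen φ (f a)) ∘ₗ mapGen φ from
    LinearMap.congr_fun h x
  refine hom_ext fun t => ?_
  simp only [LinearMap.comp_apply]
  induction t with
  | leaf a =>
    change mapGen φ (subst f (X a)) = subst _ (mapGen φ (X a))
    rw [subst_X, mapGen_X, subst_X]
  | node v s t hs ht => simp only [← mul_mk, subst_mul, mapGen_mul, hs, ht]

lemma mapGen_rename (φ : V.Iso W) (f : α → β) (x : Carrier V α) :
    mapGen φ (rename f x) = rename f (mapGen φ x) := by
  simp only [rename, mapGen_subst, mapGen_X]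

lemma mapGen_mapGen (φ : V.Iso W) (ψ : W.Iso V) (h : ∀ v, ψ.equiv (φ.equiv v) = v)
    (x : Carrier V α) : mapGen ψ (mapGen φ x) = x := by
  suffices h : mapGen ψ ∘ₗ mapGen φ = (LinearMap.id : Carrier V α →ₗ[k] _) from
    LinearMap.congr_fun h x
  refine hom_ext fun t => ?_
  simp only [LinearMap.comp_apply, LinearMap.id_apply]
  induction t with
  | leaf a =>
    change mapGen ψ (mapGen φ (X a)) = X a
    rw [mapGen_X, mapGen_X]
  | node v s t hs ht => rw [← mul_mk, mapGen_mul, mapGen_mul, hs, ht, h]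

end Functoriality

end FreeGen

section FreeIso

variable {k : Type u} [CommRing k] {V W : SymTwoModule k}

/-- The inverse of an isomorphism of `k[𝕊_2]`-modules. -/
def SymTwoModule.Iso.symm (φ : V.Iso W) : W.Iso V where
  equiv := φ.equiv.symm
  map_swap w := by
    rw [LinearEquiv.symm_apply_eq, φ.map_swap, LinearEquiv.apply_symm_apply]

/-- The free operad is functorial with respect to isomorphisms of the generators. -/
noncomputable def freeOperadIso (φ : V.Iso W) : Operad.Iso (freeOperad V) (freeOperad W) where
  equiv n := LinearEquiv.ofLinearMap (FreeGen.mapFree φ n) (FreeGen.mapFree φ.symm n)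
    (LinearMap.ext fun x => Subtype.ext
      (FreeGen.mapGen_mapGen φ.symm φ φ.equiv.apply_symm_apply x.1))
    (LinearMap.ext fun x => Subtype.ext
      (FreeGen.mapGen_mapGen φ φ.symm φ.equiv.symm_apply_apply x.1))
  map_act σ p := Subtype.ext (FreeGen.mapGen_rename φ σ.symm p.1)
  map_one := Subtype.ext (FreeGen.mapGen_X φ 0)
  map_comp e p q := Subtype.ext (by
    refine (FreeGen.mapGen_subst φ _ p.1).trans ?_
    simp only [FreeGen.mapGen_rename]
    rfl)

lemma freeOperadIso_genOp (φ : V.Iso W) (v : V.carrier) :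
    (freeOperadIso φ).equiv 2 (FreeGen.genOp v) = FreeGen.genOp (φ.equiv v) :=
  Subtype.ext <| (FreeGen.mapGen_mul φ v _ _).trans <| by
    rw [FreeGen.mapGen_X, FreeGen.mapGen_X]; rfl

/-- An isomorphism of generators which carries the relations onto the relations induces an
isomorphism of quadratic operads. -/
theorem QuadraticData.exists_operadIso (D E : QuadraticData k) (φ : D.gen.Iso E.gen)
    (h : D.rel.map (FreeGen.mapFree φ 3) = E.rel) :
    ∃ Φ : Operad.Iso D.operad E.operad, ∀ v, Φ.equiv 2 (D.op v) = E.op (φ.equiv v) := by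
  have hrel : ∀ n, (freeOperadIso φ).equiv n '' D.relFamily n = E.relFamily n := by
    intro n
    by_cases hn : n = 3
    · subst hn
      exact congrArg SetLike.coe h
    · have h0 : ∀ D : QuadraticData k, D.relFamily n = ∅ := fun D => by
        unfold relFamily
        split
        · exact absurd rfl hn
        · rfl
      rw [h0, h0, Set.image_empty]
  refine ⟨(freeOperadIso φ).quotient _ _ (Operad.Ideal.map_span _ hrel), fun v => ?_⟩
  exact congrArg Submodule.Quotient.mk (freeOperadIso_genOp φ v)

end FreeIso

/-! ### The weight two part of the free operad -/

namespace BinTree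

variable {V : Type u} {α : Type} [Fintype α] [DecidableEq α]

/-- The number of leaves. -/
def size (t : BinTree V α) : ℕ := ∑ a, t.occ a

lemma size_leaf (a : α) : (leaf a : BinTree V α).size = 1 := by simp [size, occ]

lemma size_node (v : V) (s t : BinTree V α) : (node v s t).size = s.size + t.size :=
  Finset.sum_add_distrib

lemma size_pos (t : BinTree V α) : 0 < t.size := by
  induction t with
  | leaf a => simp [size_leaf]
  | node v s t hs _ => rw [size_node]; omega

lemma exists_leaf_of_size_eq_one {t : BinTree V α} (h : t.size = 1) : ∃ a, t = leaf a := by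
  cases t with
  | leaf a => exact ⟨a, rfl⟩
  | node v s t =>
    have := s.size_pos
    have := t.size_pos
    rw [size_node] at h
    omega

lemma exists_node_of_size_eq_two {t : BinTree V α} (h : t.size = 2) :
    ∃ v a b, t = node v (leaf a) (leaf b) := by
  cases t with
  | leaf a => simp [size_leaf] at h
  | node v s t =>
    have := s.size_pos
    have := t.size_pos
    rw [size_node] at h
    obtain ⟨a, rfl⟩ := exists_leaf_of_size_eq_one (t := s) (by omega)
    obtain ⟨b, rfl⟩ := exists_leaf_of_size_eq_one (t := t) (by omega)
    exact ⟨v, a, b, rfl⟩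

end BinTree

namespace FreeGen

variable {k : Type u} [CommRing k] {V W : SymTwoModule k}

lemma mul_swap {α : Type} (v : V.carrier) (x y : Carrier V α) :
    mul (V.swap v) x y = mul v y x := (alg V α).mul_swap v x y

/-- The tree `v(w(c + 1, c + 2), c)` with two vertices, for `c` modulo `3`. -/
noncomputable def comb (c : Fin 3) : V.carrier →ₗ[k] V.carrier →ₗ[k] (freeOperad V).obj 3 :=
  LinearMap.mk₂ k (fun v w => ⟨mul v (mul w (X (c + 1)) (X (c + 2))) (X c), by
      have h := mul_mem_degree v (mul_mem_degree w (X_mem_degree (V := V) (c + 1))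
        (X_mem_degree (c + 2))) (X_mem_degree c)
      have hc : (fun b : Fin 3 => ((if c + 1 = b then 1 else 0) + if c + 2 = b then 1 else 0) +
          if c = b then 1 else 0) = fun _ => 1 := by
        clear h; revert c; decide
      rwa [hc] at h⟩)
    (fun v v' w => Subtype.ext ((alg V _).add_mul' v v' _ _))
    (fun a v w => Subtype.ext ((alg V _).smul_mul' a v _ _))
    (fun v w w' => Subtype.ext <| by
      simp only [mul, (alg V _).add_mul', (alg V _).mul_add_left]; rfl)
    (fun a v w => Subtype.ext <| by
      simp only [mul, (alg V _).smul_mul', (alg V _).mul_smul_left]; rfl)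

lemma coe_comb (c : Fin 3) (v w : V.carrier) :
    (comb c v w).1 = mul v (mul w (X (c + 1)) (X (c + 2))) (X c) := rfl

lemma mapFree_comb (φ : V.Iso W) (c : Fin 3) (v w : V.carrier) :
    mapFree φ 3 (comb c v w) = comb c (φ.equiv v) (φ.equiv w) :=
  Subtype.ext <| (mapGen_mul φ _ _ _).trans <| by
    rw [mapGen_mul, mapGen_X, mapGen_X, mapGen_X, coe_comb]

lemma coef_comb (a c : Fin 3) (v w : V.carrier) :
    coef (a + 1) (a + 2) a (comb c v w).1 = if a = c then v ⊗ₜ[k] w else 0 := by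
  change (coefs (comb c v w).1).2.2 (a + 1) (a + 2) a = _
  simp only [coe_comb, coefs_mul, coefs_X, coefAlg]
  split_ifs with h
  · subst h
    simp
  · simp [Pi.single_apply, h]

/-- Every tree with the leaves `0, 1, 2` is a `comb`, up to exchanging the two inputs of its
vertices. -/
lemma mk_eq_comb (t : BinTree V.carrier (Fin 3)) (ht : ∀ a, t.occ a = 1) :
    ∃ c v w, mk t = (comb c v w).1 := by
  have key : ∀ (v w : V.carrier) (a b c : Fin 3),
      (∀ d, (BinTree.node v (.node w (.leaf a) (.leaf b)) (.leaf c)).occ d = 1) →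
      ∃ c' v' w', mul v (mul w (X a) (X b)) (X c) = (comb c' v' w').1 := by
    intro v w a b c h
    have h' : a = c + 1 ∧ b = c + 2 ∨ a = c + 2 ∧ b = c + 1 := by
      simp only [BinTree.occ] at h
      revert a b c; decide
    rcases h' with ⟨rfl, rfl⟩ | ⟨rfl, rfl⟩
    · exact ⟨c, v, w, rfl⟩
    · exact ⟨c, v, V.swap w, by rw [coe_comb, mul_swap]⟩
  have hsize : t.size = 3 := by simp [BinTree.size, ht]
  cases t with
  | leaf a => simp [BinTree.size_leaf] at hsize
  | node v s t =>
    have h1 := s.size_pos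
    have h2 := t.size_pos
    rw [BinTree.size_node] at hsize
    obtain ⟨hs, ht'⟩ | ⟨hs, ht'⟩ : s.size = 1 ∧ t.size = 2 ∨ s.size = 2 ∧ t.size = 1 := by omega
    · obtain ⟨c, rfl⟩ := BinTree.exists_leaf_of_size_eq_one hs
      obtain ⟨w, a, b, rfl⟩ := BinTree.exists_node_of_size_eq_two ht'
      rw [← mul_mk, ← mul_mk, ← mul_swap]
      refine key (V.swap v) w a b c fun d => ?_
      rw [← ht d]
      exact Nat.add_comm _ _
    · obtain ⟨c, rfl⟩ := BinTree.exists_leaf_of_size_eq_one ht'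
      obtain ⟨w, a, b, rfl⟩ := BinTree.exists_node_of_size_eq_two hs
      rw [← mul_mk, ← mul_mk]
      exact key v w a b c ht

lemma span_comb (V : SymTwoModule k) :
    Submodule.span k {x : (freeOperad V).obj 3 | ∃ c v w, x = comb c v w} = ⊤ := by
  refine (Submodule.eq_top_iff').2 fun ⟨y, hy⟩ => ?_
  induction hy using Submodule.span_induction with
  | zero => exact zero_mem _
  | add a b _ _ h h' => exact add_mem h h'
  | smul a b _ h => exact Submodule.smul_mem _ a h
  | mem z hz =>
    obtain ⟨t, ht, rfl⟩ := hz
    obtain ⟨c, v, w, h⟩ := mk_eq_comb t ht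
    exact Submodule.subset_span ⟨c, v, w, Subtype.ext h⟩

/-- The coefficients in `V ⊗ V` of the three shapes of trees with two vertices. -/
noncomputable def weightTwoCoef (V : SymTwoModule k) :
    (freeOperad V).obj 3 →ₗ[k] (Fin 3 → V.carrier ⊗[k] V.carrier) :=
  LinearMap.pi fun c => (coef (c + 1) (c + 2) c).comp (multilinear V 3).subtype

lemma weightTwoCoef_comb (c : Fin 3) (v w : V.carrier) :
    weightTwoCoef V (comb c v w) = Pi.single c (v ⊗ₜ[k] w) := by
  funext a
  rw [Pi.single_apply]
  exact coef_comb a c v w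

/-- `F(V)(3)` is the sum of three copies of `V ⊗ V`, indexed by the leaf adjacent to the root. -/
noncomputable def weightTwoEquiv (V : SymTwoModule k) :
    (freeOperad V).obj 3 ≃ₗ[k] (Fin 3 → V.carrier ⊗[k] V.carrier) :=
  LinearEquiv.ofLinearMap (weightTwoCoef V)
    (LinearMap.lsum k (fun _ : Fin 3 => V.carrier ⊗[k] V.carrier) k
      fun c => TensorProduct.lift (comb c))
    (by
      refine LinearMap.pi_ext' fun c => TensorProduct.ext' fun v w => ?_
      simp only [LinearMap.comp_apply, LinearMap.coe_single, LinearMap.lsum_piSingle,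
        TensorProduct.lift.tmul, weightTwoCoef_comb, LinearMap.id_apply])
    (by
      refine LinearMap.ext_on (span_comb V) ?_
      rintro _ ⟨c, v, w, rfl⟩
      simp only [LinearMap.comp_apply, weightTwoCoef_comb, LinearMap.lsum_piSingle,
        TensorProduct.lift.tmul, LinearMap.id_apply])

lemma weightTwoEquiv_symm_single (c : Fin 3) (v w : V.carrier) :
    (weightTwoEquiv V).symm (Pi.single c (v ⊗ₜ[k] w)) = comb c v w := by
  rw [LinearEquiv.symm_apply_eq]
  exact (weightTwoCoef_comb c v w).symm

/-- The basis of `F(V)(3)` given by the trees `v(w(c + 1, c + 2), c)`, for `v, w` in a basis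
of `V`. -/
noncomputable def treeBasis {ι : Type*} (b : Module.Basis ι k V.carrier) :
    Module.Basis (Fin 3 × ι × ι) k ((freeOperad V).obj 3) :=
  ((Pi.basis fun _ : Fin 3 => b.tensorProduct b).reindex (Equiv.sigmaEquivProd _ _)).map
    (weightTwoEquiv V).symm

lemma treeBasis_apply {ι : Type*} (b : Module.Basis ι k V.carrier) (c : Fin 3) (i j : ι) :
    treeBasis b (c, i, j) = comb c (b i) (b j) := by
  classical
  simp only [treeBasis, Module.Basis.map_apply, Module.Basis.reindex_apply,
    Equiv.sigmaEquivProd_symm_apply, Pi.basis_apply, Module.Basis.tensorProduct_apply]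
  exact weightTwoEquiv_symm_single _ _ _

lemma pairing_comb (c c' : Fin 3) (f g : Module.Dual k V.carrier) (v w : V.carrier) :
    pairing V (comb (V := V.czechDual) c f g) (comb c' v w) = if c = c' then f v * g w else 0 := by
  rw [pairing_apply]
  simp only [coef_comb, coef_comb (V := V.czechDual)]
  split_ifs with h
  · subst h
    rw [Finset.sum_eq_single c] <;> simp +contextual
  · refine Finset.sum_eq_zero fun a _ => ?_
    by_cases ha : a = c
    · subst ha; simp [h]
    · simp [ha]

end FreeGen

/-! ### Sums and differences along the fibres of a map between indices -/

section Fibers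

variable {K M M' ι κ : Type*} [Field K] [AddCommGroup M] [Module K M] [AddCommGroup M']
  [Module K M'] [Fintype ι] [Fintype κ] [DecidableEq κ]

/-- The sum of the basis vectors indexed by the fibre of `Δ` over `a`. -/
noncomputable def fiberSum (m : Module.Basis ι K M) (Δ : ι → κ) (a : κ) : M := ∑ i with Δ i = a, m i

/-- The span of the differences of basis vectors whose indices have the same image under `Δ`. -/
def fiberDiff (m : Module.Basis ι K M) (Δ : ι → κ) : Submodule K M :=
  Submodule.span K {x | ∃ i j, Δ i = Δ j ∧ x = m i - m j}

variable (m : Module.Basis ι K M) (m' : Module.Basis ι K M') {Δ : ι → κ} {s : κ → ι}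

lemma repr_sum_fiberSum (g : κ → K) (i : ι) :
    m.repr (∑ a, g a • fiberSum m Δ a) i = g (Δ i) := by
  have h : ∑ a, g a • fiberSum m Δ a = ∑ i, g (Δ i) • m i := by
    rw [← Finset.sum_fiberwise Finset.univ Δ]
    refine Finset.sum_congr rfl fun a _ => ?_
    rw [fiberSum, Finset.smul_sum]
    exact Finset.sum_congr rfl fun i hi => by rw [(Finset.mem_filter.1 hi).2]
  rw [h, m.repr_sum_self]

lemma linearIndependent_fiberSum (hs : ∀ a, Δ (s a) = a) :
    LinearIndependent K (fiberSum m Δ) := by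
  refine Fintype.linearIndependent_iff.2 fun g hg a => ?_
  have := repr_sum_fiberSum m (Δ := Δ) g (s a)
  rwa [hg, map_zero, Finsupp.zero_apply, hs, eq_comm] at this

lemma finrank_span_fiberSum (hs : ∀ a, Δ (s a) = a) :
    Module.finrank K (Submodule.span K (Set.range (fiberSum m Δ))) = Fintype.card κ :=
  finrank_span_eq_card (linearIndependent_fiberSum m hs)

/-- The orthogonal of the differences along the fibres consists of the sums over the fibres. -/
lemma mem_span_fiberSum_iff (hs : ∀ a, Δ (s a) = a) (B : M' →ₗ[K] M →ₗ[K] K)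
    (hB : ∀ f j, B f (m j) = m'.repr f j) (f : M') :
    f ∈ Submodule.span K (Set.range (fiberSum m' Δ)) ↔ ∀ r ∈ fiberDiff m Δ, B f r = 0 := by
  rw [Submodule.mem_span_range_iff_exists_fun]
  constructor
  · rintro ⟨g, rfl⟩ r hr
    induction hr using Submodule.span_induction with
    | zero => exact map_zero _
    | add _ _ _ _ h h' => rw [map_add, h, h', add_zero]
    | smul c _ _ h => rw [map_smul, h, smul_zero]
    | mem x hx =>
      obtain ⟨i, j, hij, rfl⟩ := hx
      rw [map_sub, hB, hB, repr_sum_fiberSum, repr_sum_fiberSum, hij, sub_self]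
  · intro h
    refine ⟨fun a => m'.repr f (s a), m'.repr.injective (Finsupp.ext fun i => ?_)⟩
    rw [repr_sum_fiberSum, ← hB, ← hB, ← sub_eq_zero, ← map_sub]
    exact h _ (Submodule.subset_span ⟨_, _, hs _, rfl⟩)

/-- The differences along the fibres span the kernel of the map `m i ↦ e_{Δ i}` onto `K^κ`. -/
lemma finrank_fiberDiff (hs : ∀ a, Δ (s a) = a) :
    Module.finrank K (fiberDiff m Δ) = Fintype.card ι - Fintype.card κ := by
  classical
  let P : M →ₗ[K] κ → K := m.constr K fun i => Pi.single (Δ i) 1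
  have hP : ∀ i, P (m i) = Pi.single (Δ i) 1 := fun i => m.constr_basis K _ i
  have hker : LinearMap.ker P = fiberDiff m Δ := by
    refine le_antisymm (fun x hx => ?_) (Submodule.span_le.2 ?_)
    · -- `x` is congruent to `∑ i, x_i m_{s (Δ i)}`, which is the image of `P x`
      let Q : (κ → K) →ₗ[K] M := (Pi.basisFun K κ).constr K fun a => m (s a)
      have key : ∀ y, y - Q (P y) ∈ fiberDiff m Δ := by
        intro y
        induction m.mem_span y using Submodule.span_induction with
        | zero => simp
        | add a b _ _ ha hb =>
          rw [map_add, map_add, add_sub_add_comm]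
          exact add_mem ha hb
        | smul c a _ ha =>
          rw [map_smul, map_smul, ← smul_sub]
          exact Submodule.smul_mem _ c ha
        | mem x hx =>
          obtain ⟨i, rfl⟩ := hx
          rw [hP, ← Pi.basisFun_apply, Module.Basis.constr_basis]
          exact Submodule.subset_span ⟨_, _, (hs _).symm, rfl⟩
      simpa [LinearMap.mem_ker.1 hx] using key x
    · rintro _ ⟨i, j, hij, rfl⟩
      rw [SetLike.mem_coe, LinearMap.mem_ker, map_sub, hP, hP, hij, sub_self]
  have hsurj : LinearMap.range P = ⊤ := by
    rw [eq_top_iff, ← (Pi.basisFun K κ).span_eq, Submodule.span_le]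
    rintro _ ⟨a, rfl⟩
    exact ⟨m (s a), by rw [hP, hs, Pi.basisFun_apply]⟩
  have := Module.Finite.of_basis m
  have h := P.finrank_range_add_finrank_ker
  rw [hsurj, finrank_top, Module.finrank_fintype_fun_eq_card, hker,
    Module.finrank_eq_card_basis m] at h
  omega

end Fibers

/-! ### Trees and relators in coordinates -/

namespace FreeGen

variable {k : Type u} [CommRing k] {V : SymTwoModule k}

section Trees

/-! In the following lemmas the transposition acts on the basis `b` by a permutation `τ` of the
indices, up to a common scalar `ε`.  They rewrite the trees with the leaves `c`, `c + 1`, `c + 2` in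
terms of `treeBasis b`, according to the leaf adjacent to the root and to the order of the two
other leaves. -/

variable {ι : Type*} {b : Module.Basis ι k V.carrier} {τ : ι → ι} {ε : k}

lemma mul_X_mul (hb : ∀ i, V.swap (b i) = ε • b (τ i)) (i : ι) (w : V.carrier) {α : Type} (a : α)
    (x y : Carrier V α) :
    mul (b i) (X a) (mul w x y) = ε • mul (b (τ i)) (mul w x y) (X a) := by
  rw [← mul_swap, hb]
  exact (alg V α).smul_mul' _ _ _ _

variable (b) in
lemma tree_zero (c : Fin 3) (i j : ι) :
    mul (b i) (mul (b j) (X (c + 1)) (X (c + 2))) (X c) = (treeBasis b (c, i, j)).1 := by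
  rw [treeBasis_apply, coe_comb]

variable (b) in
lemma tree_one (c : Fin 3) (i j : ι) :
    mul (b i) (mul (b j) (X (c + 2)) (X c)) (X (c + 1)) = (treeBasis b (c + 1, i, j)).1 := by
  rw [← tree_zero, show c + 1 + 1 = c + 2 by revert c; decide,
    show c + 1 + 2 = c by revert c; decide]

variable (b) in
lemma tree_two (c : Fin 3) (i j : ι) :
    mul (b i) (mul (b j) (X c) (X (c + 1))) (X (c + 2)) = (treeBasis b (c + 2, i, j)).1 := by
  rw [← tree_zero, show c + 2 + 1 = c by revert c; decide,
    show c + 2 + 2 = c + 1 by revert c; decide]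

lemma mul_mul_swap (hb : ∀ i, V.swap (b i) = ε • b (τ i)) (v : V.carrier) (j : ι) {α : Type}
    (x y z : Carrier V α) :
    mul v (mul (b j) y x) z = ε • mul v (mul (b (τ j)) x y) z := by
  rw [← mul_swap (b j), hb]
  refine (congrArg (mul v · z) ((alg V α).smul_mul' ε (b (τ j)) x y)).trans ?_
  exact (alg V α).mul_smul_left _ _ _ _

lemma tree_zero_swap (hb : ∀ i, V.swap (b i) = ε • b (τ i)) (c : Fin 3) (i j : ι) :
    mul (b i) (mul (b j) (X (c + 2)) (X (c + 1))) (X c) =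
      ε • (treeBasis b (c, i, τ j)).1 := by
  rw [← tree_zero, mul_mul_swap hb]

lemma tree_one_swap (hb : ∀ i, V.swap (b i) = ε • b (τ i)) (c : Fin 3) (i j : ι) :
    mul (b i) (mul (b j) (X c) (X (c + 2))) (X (c + 1)) =
      ε • (treeBasis b (c + 1, i, τ j)).1 := by
  rw [← tree_one, mul_mul_swap hb]

lemma tree_two_swap (hb : ∀ i, V.swap (b i) = ε • b (τ i)) (c : Fin 3) (i j : ι) :
    mul (b i) (mul (b j) (X (c + 1)) (X c)) (X (c + 2)) =
      ε • (treeBasis b (c + 2, i, τ j)).1 := by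
  rw [← tree_two, mul_mul_swap hb]

end Trees

/-- A permutation of the three inputs is `(c, c + 1, c + 2)` or `(c, c + 2, c + 1)` for a
unique `c`. -/
lemma setOf_relators
    (rel : Carrier V (Fin 3) → Carrier V (Fin 3) → Carrier V (Fin 3) → Set (Carrier V (Fin 3))) :
    {r | ∃ σ : Equiv.Perm (Fin 3), r ∈ rel (X (σ 0)) (X (σ 1)) (X (σ 2))} =
      {r | ∃ c : Fin 3, r ∈ rel (X c) (X (c + 1)) (X (c + 2)) ∨
        r ∈ rel (X c) (X (c + 2)) (X (c + 1))} := by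
  ext r
  constructor
  · rintro ⟨σ, hσ⟩
    have h : σ 1 = σ 0 + 1 ∧ σ 2 = σ 0 + 2 ∨ σ 1 = σ 0 + 2 ∧ σ 2 = σ 0 + 1 := by
      clear hσ; revert σ; decide
    rcases h with ⟨h1, h2⟩ | ⟨h1, h2⟩ <;> rw [h1, h2] at hσ
    exacts [⟨_, .inl hσ⟩, ⟨_, .inr hσ⟩]
  · have h1 : ∀ c : Fin 3, ∃ σ : Equiv.Perm (Fin 3), σ 0 = c ∧ σ 1 = c + 1 ∧ σ 2 = c + 2 := by
      decide
    have h2 : ∀ c : Fin 3, ∃ σ : Equiv.Perm (Fin 3), σ 0 = c ∧ σ 1 = c + 2 ∧ σ 2 = c + 1 := by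
      decide
    rintro ⟨c, h | h⟩
    · obtain ⟨σ, h0, h1, h2⟩ := h1 c
      exact ⟨σ, by rwa [h0, h1, h2]⟩
    · obtain ⟨σ, h0, h1, h2⟩ := h2 c
      exact ⟨σ, by rwa [h0, h1, h2]⟩

variable {rel : Carrier V (Fin 3) → Carrier V (Fin 3) → Carrier V (Fin 3) →
  Set (Carrier V (Fin 3))}

lemma relatorSpan_le {N : Submodule k ((freeOperad V).obj 3)}
    (h : ∀ c, ∀ r ∈ rel (X c) (X (c + 1)) (X (c + 2)), ∃ y ∈ N, r = y.1)
    (h' : ∀ c, ∀ r ∈ rel (X c) (X (c + 2)) (X (c + 1)), ∃ y ∈ N, r = y.1) :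
    relatorSpan rel ≤ N := by
  rintro ⟨x, hx⟩ hr
  rw [relatorSpan, setOf_relators] at hr
  have hle : Submodule.span k {r | ∃ c : Fin 3, r ∈ rel (X c) (X (c + 1)) (X (c + 2)) ∨
      r ∈ rel (X c) (X (c + 2)) (X (c + 1))} ≤ Submodule.map (multilinear V 3).subtype N := by
    refine Submodule.span_le.2 ?_
    rintro r ⟨c, hc | hc⟩
    · obtain ⟨y, hy, rfl⟩ := h c r hc
      exact ⟨y, hy, rfl⟩
    · obtain ⟨y, hy, rfl⟩ := h' c r hc
      exact ⟨y, hy, rfl⟩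
  obtain ⟨y, hy, hxy⟩ := hle hr
  obtain rfl : y = ⟨x, hx⟩ := Subtype.ext hxy
  exact hy

lemma mem_relatorSpan {c : Fin 3} {y : (freeOperad V).obj 3}
    (h : y.1 ∈ rel (X c) (X (c + 1)) (X (c + 2))) : y ∈ relatorSpan rel := by
  rw [relatorSpan, setOf_relators]
  exact Submodule.subset_span ⟨c, .inl h⟩

lemma mem_relatorSpan_swap {c : Fin 3} {y : (freeOperad V).obj 3}
    (h : y.1 ∈ rel (X c) (X (c + 2)) (X (c + 1))) : y ∈ relatorSpan rel := by
  rw [relatorSpan, setOf_relators]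
  exact Submodule.subset_span ⟨c, .inr h⟩

/-- The trees on a basis of `V` and the trees on the dual basis are dual bases for the pairing. -/
lemma pairing_treeBasis {ι : Type*} [DecidableEq ι] [Finite ι] (b : Module.Basis ι k V.carrier)
    (f : (freeOperad V.czechDual).obj 3) (j : Fin 3 × ι × ι) :
    pairing V f (treeBasis b j) = (treeBasis (V := V.czechDual) b.dualBasis).repr f j := by
  suffices h : (pairing V).flip (treeBasis b j) =
      (treeBasis (V := V.czechDual) b.dualBasis).coord j from LinearMap.congr_fun h f
  refine (treeBasis (V := V.czechDual) b.dualBasis).ext fun i => ?_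
  obtain ⟨c, p, q⟩ := i
  obtain ⟨c', p', q'⟩ := j
  rw [LinearMap.flip_apply, Module.Basis.coord_apply, Module.Basis.repr_self, treeBasis_apply,
    treeBasis_apply, pairing_comb]
  simp only [Module.Basis.dualBasis_apply_self, Finsupp.single_apply, Prod.mk.injEq]
  by_cases h : c = c' <;> by_cases h' : p = p' <;> by_cases h'' : q = q' <;>
    simp [h, h', h'', eq_comm]

end FreeGen

/-! ### The duality between `ComTrias` and `PostLie` -/

section Duality

open FreeGen

variable (k : Type u) [Field k]

/-- The basis `*`, `*·(12)`, `•`. -/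
noncomputable def comTriasBasis : Module.Basis (Fin 3) k (comTriasGen k).carrier :=
  Module.Basis.ofEquivFun
    { toFun := fun x => ![x.1.1, x.1.2, x.2]
      invFun := fun f => ((f 0, f 1), f 2)
      map_add' := fun x y => by ext i; fin_cases i <;> rfl
      map_smul' := fun a x => by ext i; fin_cases i <;> rfl
      left_inv := fun x => rfl
      right_inv := fun f => by ext i; fin_cases i <;> rfl }

/-- The basis `∘`, `-∘·(12)`, `[,]`.  The signs are those by which the transposition acts on the
dual of the basis `*`, `*·(12)`, `•` in `V^∨ = V^* ⊗ sgn`. -/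
noncomputable def postLieBasis : Module.Basis (Fin 3) k (postLieGen k).carrier :=
  Module.Basis.ofEquivFun
    { toFun := fun x => ![x.1.1, -x.1.2, x.2]
      invFun := fun f => ((f 0, -f 1), f 2)
      map_add' := fun x y => by ext i; fin_cases i <;> simp [add_comm]
      map_smul' := fun a x => by ext i; fin_cases i <;> simp
      left_inv := fun x => by simp
      right_inv := fun f => by ext i; fin_cases i <;> simp }

lemma comTriasBasis_apply (i : Fin 3) : comTriasBasis k i =
    ((Pi.single (M := fun _ => k) i 1 0, Pi.single (M := fun _ => k) i 1 1),
      Pi.single (M := fun _ => k) i 1 2) := by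
  rw [comTriasBasis, Module.Basis.coe_ofEquivFun]
  rfl

lemma postLieBasis_apply (i : Fin 3) : postLieBasis k i =
    ((Pi.single (M := fun _ => k) i 1 0, -Pi.single (M := fun _ => k) i 1 1),
      Pi.single (M := fun _ => k) i 1 2) := by
  rw [postLieBasis, Module.Basis.coe_ofEquivFun]
  rfl

lemma comTriasStar_eq : comTriasStar k = comTriasBasis k 0 := by
  rw [comTriasBasis_apply]
  simp [comTriasStar]

lemma comTriasBullet_eq : comTriasBullet k = comTriasBasis k 2 := by
  rw [comTriasBasis_apply]
  simp [comTriasBullet]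

lemma postLieCirc_eq : postLieCirc k = postLieBasis k 0 := by
  rw [postLieBasis_apply]
  simp [postLieCirc]

lemma postLieBracket_eq : postLieBracket k = postLieBasis k 2 := by
  rw [postLieBasis_apply]
  simp [postLieBracket]

lemma swap_comTriasBasis (i : Fin 3) :
    (comTriasGen k).swap (comTriasBasis k i) = (1 : k) • comTriasBasis k (Equiv.swap 0 1 i) := by
  rw [comTriasBasis_apply, comTriasBasis_apply]
  fin_cases i <;> simp [Equiv.swap_apply_of_ne_of_ne]

lemma swap_postLieBasis (i : Fin 3) :
    (postLieGen k).swap (postLieBasis k i) = (-1 : k) • postLieBasis k (Equiv.swap 0 1 i) := by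
  rw [postLieBasis_apply, postLieBasis_apply]
  fin_cases i <;> simp [Equiv.swap_apply_of_ne_of_ne]

/-- The isomorphism `V^∨ ≅ W` matching the dual of the basis `*`, `*·(12)`, `•` with the basis
`∘`, `-∘·(12)`, `[,]`. -/
noncomputable def genIso : (comTriasGen k).czechDual.Iso (postLieGen k) where
  equiv := (comTriasBasis k).dualBasis.equiv (postLieBasis k) (Equiv.refl _)
  map_swap f := by
    suffices h : ((comTriasBasis k).dualBasis.equiv (postLieBasis k) (Equiv.refl _)).toLinearMap ∘ₗ
        (comTriasGen k).czechDual.swap = (postLieGen k).swap ∘ₗ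
        ((comTriasBasis k).dualBasis.equiv (postLieBasis k) (Equiv.refl _)).toLinearMap from
      LinearMap.congr_fun h f
    have h : ∀ i, (comTriasGen k).czechDual.swap ((comTriasBasis k).dualBasis i) =
        (-1 : k) • (comTriasBasis k).dualBasis (Equiv.swap 0 1 i) := by
      intro i
      refine (comTriasBasis k).ext fun j => ?_
      change -((comTriasBasis k).dualBasis i ((comTriasGen k).swap (comTriasBasis k j))) = _
      rw [swap_comTriasBasis, one_smul, Module.Basis.dualBasis_apply_self, LinearMap.smul_apply,
        Module.Basis.dualBasis_apply_self, neg_one_smul]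
      simp only [Equiv.swap_apply_eq_iff]
    refine (comTriasBasis k).dualBasis.ext fun i => ?_
    rw [LinearMap.comp_apply, LinearMap.comp_apply, h, map_smul, LinearEquiv.coe_coe,
      Module.Basis.equiv_apply, Module.Basis.equiv_apply]
    exact (swap_postLieBasis k i).symm

lemma genIso_dualBasis (i : Fin 3) :
    (genIso k).equiv ((comTriasBasis k).dualBasis i) = postLieBasis k i :=
  Module.Basis.equiv_apply _ _ _ _

lemma dualStar_eq : dualStar k = (comTriasBasis k).dualBasis 0 := by
  refine (comTriasBasis k).ext fun j => ?_
  rw [Module.Basis.dualBasis_apply_self, comTriasBasis_apply]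
  change Pi.single (M := fun _ => k) j 1 0 = _
  simp [Pi.single_apply, eq_comm]

lemma dualBullet_eq : dualBullet k = (comTriasBasis k).dualBasis 2 := by
  refine (comTriasBasis k).ext fun j => ?_
  rw [Module.Basis.dualBasis_apply_self, comTriasBasis_apply]
  change Pi.single (M := fun _ => k) j 1 2 = _
  simp [Pi.single_apply, eq_comm]

/-- The nonempty subsets of the set `{0, 1, 2}` of inputs: the singletons `{c}`, the pairs
`{c + 1, c + 2}` (with `c` modulo `3`), and the whole set. -/
abbrev Support := Fin 3 ⊕ Fin 3 ⊕ Unit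

/-- The set of inputs attached to a tree of `treeBasis (comTriasBasis k)`: at each vertex, `*` keeps
the set of its first input, `*·(12)` keeps the set of its second input, and `•` takes the union.
Two trees are equal in `ComTrias` if and only if they have the same support. -/
def support : Fin 3 × Fin 3 × Fin 3 → Support
  | (c, 0, 0) => .inl (c + 1)
  | (c, 0, 1) => .inl (c + 2)
  | (c, 0, 2) => .inr (.inl c)
  | (c, 1, _) => .inl c
  | (c, 2, 0) => .inr (.inl (c + 2))
  | (c, 2, 1) => .inr (.inl (c + 1))
  | (_, 2, 2) => .inr (.inr ())

/-- A choice of a tree with a given support. -/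
def supportRep : Support → Fin 3 × Fin 3 × Fin 3
  | .inl c => (c, 1, 0)
  | .inr (.inl c) => (c, 0, 2)
  | .inr (.inr _) => (0, 2, 2)

lemma support_supportRep (a : Support) : support (supportRep a) = a := by
  revert a; decide

lemma fiber_singleton (c : Fin 3) : ({i | support i = .inl c} : Finset _) =
    {(c, 1, 0), (c, 1, 1), (c, 1, 2), (c + 2, 0, 0), (c + 1, 0, 1)} := by
  revert c; decide

lemma fiber_pair (c : Fin 3) : ({i | support i = .inr (.inl c)} : Finset _) =
    {(c, 0, 2), (c + 1, 2, 0), (c + 2, 2, 1)} := by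
  revert c; decide

lemma fiber_all (c : Fin 3) : ({i | support i = .inr (.inr ())} : Finset _) =
    {(c, 2, 2), (c + 1, 2, 2), (c + 2, 2, 2)} := by
  revert c; decide

section FiberSum

variable {k} {V : SymTwoModule k} (b : Module.Basis (Fin 3) k V.carrier) (c : Fin 3)

lemma coe_fiberSum_singleton : (fiberSum (treeBasis b) support (.inl c)).1 =
    (treeBasis b (c, 1, 0)).1 + (treeBasis b (c, 1, 1)).1 + (treeBasis b (c, 1, 2)).1 +
      (treeBasis b (c + 2, 0, 0)).1 + (treeBasis b (c + 1, 0, 1)).1 := by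
  have h : fiberSum (treeBasis b) support (.inl c) =
      treeBasis b (c, 1, 0) + treeBasis b (c, 1, 1) + treeBasis b (c, 1, 2) +
        treeBasis b (c + 2, 0, 0) + treeBasis b (c + 1, 0, 1) := by
    rw [fiberSum, fiber_singleton]
    simp [add_assoc]
  rw [h]
  rfl

lemma coe_fiberSum_pair : (fiberSum (treeBasis b) support (.inr (.inl c))).1 =
    (treeBasis b (c, 0, 2)).1 + (treeBasis b (c + 1, 2, 0)).1 + (treeBasis b (c + 2, 2, 1)).1 := by
  have h : fiberSum (treeBasis b) support (.inr (.inl c)) =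
      treeBasis b (c, 0, 2) + treeBasis b (c + 1, 2, 0) + treeBasis b (c + 2, 2, 1) := by
    rw [fiberSum, fiber_pair]
    simp [add_assoc]
  rw [h]
  rfl

lemma coe_fiberSum_all : (fiberSum (treeBasis b) support (.inr (.inr ()))).1 =
    (treeBasis b (c, 2, 2)).1 + (treeBasis b (c + 1, 2, 2)).1 + (treeBasis b (c + 2, 2, 2)).1 := by
  have h : fiberSum (treeBasis b) support (.inr (.inr ())) =
      treeBasis b (c, 2, 2) + treeBasis b (c + 1, 2, 2) + treeBasis b (c + 2, 2, 2) := by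
    rw [fiberSum, fiber_all c]
    simp [add_assoc]
  rw [h]
  rfl

end FiberSum

variable {k} in
lemma exists_mem_fiberDiff {ι κ : Type*} {V : SymTwoModule k} (b : Module.Basis ι k V.carrier)
    {Δ : Fin 3 × ι × ι → κ} (i j : Fin 3 × ι × ι) (h : Δ i = Δ j) :
    ∃ y ∈ fiberDiff (treeBasis b) Δ, (treeBasis b i).1 - (treeBasis b j).1 = y.1 :=
  ⟨_, Submodule.subset_span ⟨i, j, h, rfl⟩, rfl⟩

/-- The relators of `ComTrias` in the basis of trees, for a cyclic numbering of the inputs. -/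
lemma comTriasRelators_cyclic (c : Fin 3) :
    comTriasRelators (X c : Carrier (comTriasGen k) (Fin 3)) (X (c + 1)) (X (c + 2)) =
      letI t i := (treeBasis (comTriasBasis k) i).1
      { t (c + 2, 0, 0) - t (c, 1, 0), t (c, 1, 0) - t (c, 1, 1), t (c + 2, 2, 2) - t (c, 2, 2),
        t (c, 1, 2) - t (c, 1, 0), t (c + 2, 0, 2) - t (c, 2, 0) } := by
  have hb := swap_comTriasBasis k
  have h2 : Equiv.swap (0 : Fin 3) 1 2 = 2 := rfl
  simp only [comTriasRelators, comTriasStar_eq, comTriasBullet_eq, mul_X_mul hb,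
    tree_zero (comTriasBasis k), tree_two (comTriasBasis k), tree_zero_swap hb, one_smul,
    Equiv.swap_apply_left, h2]

/-- The relators of `ComTrias` in the basis of trees, for an anticyclic numbering of the inputs. -/
lemma comTriasRelators_anticyclic (c : Fin 3) :
    comTriasRelators (X c : Carrier (comTriasGen k) (Fin 3)) (X (c + 2)) (X (c + 1)) =
      letI t i := (treeBasis (comTriasBasis k) i).1
      { t (c + 1, 0, 1) - t (c, 1, 1), t (c, 1, 1) - t (c, 1, 0), t (c + 1, 2, 2) - t (c, 2, 2),
        t (c, 1, 2) - t (c, 1, 1), t (c + 1, 0, 2) - t (c, 2, 1) } := by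
  have hb := swap_comTriasBasis k
  have h2 : Equiv.swap (0 : Fin 3) 1 2 = 2 := rfl
  simp only [comTriasRelators, comTriasStar_eq, comTriasBullet_eq, mul_X_mul hb,
    tree_zero (comTriasBasis k), tree_zero_swap hb, tree_one_swap hb, one_smul,
    Equiv.swap_apply_left, h2]

lemma comTrias_rel_le :
    (comTrias k).rel ≤ fiberDiff (treeBasis (comTriasBasis k)) support := by
  refine relatorSpan_le (fun c r hr => ?_) fun c r hr => ?_
  · rw [comTriasRelators_cyclic] at hr
    rcases hr with rfl | rfl | rfl | rfl | rfl <;>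
      exact exists_mem_fiberDiff _ _ _ (by revert c; decide)
  · rw [comTriasRelators_anticyclic] at hr
    rcases hr with rfl | rfl | rfl | rfl | rfl <;>
      exact exists_mem_fiberDiff _ _ _ (by revert c; decide)

/-- The relations of `ComTrias` identify any two trees with the same support, and nothing else. -/
lemma comTrias_rel :
    (comTrias k).rel = fiberDiff (treeBasis (comTriasBasis k)) support := by
  refine le_antisymm (comTrias_rel_le k) ?_
  let t := treeBasis (comTriasBasis k)
  have hA : ∀ c i j, (t i).1 - (t j).1 ∈ comTriasRelators (X c) (X (c + 1)) (X (c + 2)) →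
      t i - t j ∈ (comTrias k).rel := fun c i j h => mem_relatorSpan h
  have hB : ∀ c i j, (t i).1 - (t j).1 ∈ comTriasRelators (X c) (X (c + 2)) (X (c + 1)) →
      t i - t j ∈ (comTrias k).rel := fun c i j h => mem_relatorSpan_swap h
  have e1 : ∀ c : Fin 3, c + 1 + 2 = c := by decide
  have e2 : ∀ c : Fin 3, c + 2 + 1 = c := by decide
  simp only [comTriasRelators_cyclic] at hA
  simp only [comTriasRelators_anticyclic] at hB
  have key : ∀ a i, support i = a → t i - t (supportRep a) ∈ (comTrias k).rel := by
    rintro (c | c | ⟨⟩) i hi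
    · have hi' : i ∈ ({i | support i = .inl c} : Finset _) := by simpa using hi
      rw [fiber_singleton] at hi'
      simp only [Finset.mem_insert, Finset.mem_singleton] at hi'
      rcases hi' with rfl | rfl | rfl | rfl | rfl
      · rw [supportRep, sub_self]
        exact zero_mem _
      · exact hB c _ _ (.inr (.inl rfl))
      · exact hA c _ _ (.inr (.inr (.inr (.inl rfl))))
      · exact hA c _ _ (.inl rfl)
      -- `(x * z) * y = x * (z * y) = x * (y * z)`
      · rw [← sub_add_sub_cancel _ (t (c, 1, 1))]
        exact add_mem (hB c _ _ (.inl rfl)) (hB c _ _ (.inr (.inl rfl)))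
    · have hi' : i ∈ ({i | support i = .inr (.inl c)} : Finset _) := by simpa using hi
      rw [fiber_pair] at hi'
      simp only [Finset.mem_insert, Finset.mem_singleton] at hi'
      rcases hi' with rfl | rfl | rfl
      · rw [supportRep, sub_self]
        exact zero_mem _
      · rw [← neg_sub, supportRep]
        exact neg_mem (hA (c + 1) _ _ (.inr (.inr (.inr (.inr (by rw [e1]; rfl))))))
      · rw [← neg_sub, supportRep]
        exact neg_mem (hB (c + 2) _ _ (.inr (.inr (.inr (.inr (by rw [e2]; rfl))))))
    · have hi' : i ∈ ({i | support i = .inr (.inr ())} : Finset _) := by simpa using hi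
      rw [fiber_all 0] at hi'
      simp only [Finset.mem_insert, Finset.mem_singleton] at hi'
      rcases hi' with rfl | rfl | rfl
      · rw [supportRep, sub_self]
        exact zero_mem _
      · exact hB 0 _ _ (.inr (.inr (.inl rfl)))
      · exact hA 0 _ _ (.inr (.inr (.inl rfl)))
  refine Submodule.span_le.2 ?_
  rintro _ ⟨i, j, hij, rfl⟩
  have := sub_mem (key _ i hij) (key _ j rfl)
  rwa [sub_sub_sub_cancel_right] at this

/-- The relators of `PostLie`, for a cyclic numbering of the inputs, are up to sign the sums over
the fibres of `support`. -/
lemma postLieRelators_cyclic (c : Fin 3) :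
    postLieRelators (X c : Carrier (postLieGen k) (Fin 3)) (X (c + 1)) (X (c + 2)) =
      letI S a := (fiberSum (treeBasis (postLieBasis k)) support a).1
      { -S (.inr (.inr ())), S (.inl c), S (.inr (.inl (c + 2))) } := by
  have hb := swap_postLieBasis k
  have h2 : Equiv.swap (0 : Fin 3) 1 2 = 2 := rfl
  have e1 : c + 2 + 1 = c := by revert c; decide
  have e2 : c + 2 + 2 = c + 1 := by revert c; decide
  beta_reduce
  rw [coe_fiberSum_singleton, coe_fiberSum_pair, coe_fiberSum_all _ c, e1, e2]
  simp only [postLieRelators, postLieCirc_eq, postLieBracket_eq, mul_X_mul hb,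
    tree_zero (postLieBasis k), tree_one (postLieBasis k), tree_two (postLieBasis k),
    tree_zero_swap hb, tree_one_swap hb, Equiv.swap_apply_left, h2]
  refine congrArg₂ insert ?_ (congrArg₂ insert ?_ (congrArg singleton ?_)) <;> module

/-- Exchanging the last two inputs changes the signs of the relators of `PostLie`, up to a
permutation of the supports. -/
lemma postLieRelators_anticyclic (c : Fin 3) :
    postLieRelators (X c : Carrier (postLieGen k) (Fin 3)) (X (c + 2)) (X (c + 1)) =
      letI S a := (fiberSum (treeBasis (postLieBasis k)) support a).1
      { S (.inr (.inr ())), -S (.inl c), -S (.inr (.inl (c + 1))) } := by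
  have hb := swap_postLieBasis k
  have h2 : Equiv.swap (0 : Fin 3) 1 2 = 2 := rfl
  have e1 : c + 1 + 1 = c + 2 := by revert c; decide
  have e2 : c + 1 + 2 = c := by revert c; decide
  beta_reduce
  rw [coe_fiberSum_singleton, coe_fiberSum_pair, coe_fiberSum_all _ c, e1, e2]
  simp only [postLieRelators, postLieCirc_eq, postLieBracket_eq, mul_X_mul hb,
    tree_zero (postLieBasis k), tree_two (postLieBasis k),
    tree_zero_swap hb, tree_one_swap hb, tree_two_swap hb, Equiv.swap_apply_left, h2]
  refine congrArg₂ insert ?_ (congrArg₂ insert ?_ (congrArg singleton ?_)) <;> module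

/-- The relations of `PostLie` are spanned by the seven sums over all the trees with a given
support. -/
lemma postLie_rel : (postLie k).rel =
    Submodule.span k (Set.range (fiberSum (treeBasis (postLieBasis k)) support)) := by
  have hS : ∀ a, fiberSum (treeBasis (postLieBasis k)) support a ∈
      Submodule.span k (Set.range (fiberSum (treeBasis (postLieBasis k)) support)) :=
    fun a => Submodule.subset_span ⟨a, rfl⟩
  refine le_antisymm (relatorSpan_le (fun c r hr => ?_) fun c r hr => ?_) (Submodule.span_le.2 ?_)
  · rw [postLieRelators_cyclic] at hr
    rcases hr with rfl | rfl | rfl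
    exacts [⟨_, neg_mem (hS _), rfl⟩, ⟨_, hS _, rfl⟩, ⟨_, hS _, rfl⟩]
  · rw [postLieRelators_anticyclic] at hr
    rcases hr with rfl | rfl | rfl
    exacts [⟨_, hS _, rfl⟩, ⟨_, neg_mem (hS _), rfl⟩, ⟨_, neg_mem (hS _), rfl⟩]
  · rintro _ ⟨c | c | ⟨⟩, rfl⟩
    · refine mem_relatorSpan (c := c) ?_
      rw [postLieRelators_cyclic]
      exact .inr (.inl rfl)
    · refine mem_relatorSpan (c := c + 1) ?_
      rw [postLieRelators_cyclic, show c + 1 + 2 = c by revert c; decide]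
      exact .inr (.inr rfl)
    · refine mem_relatorSpan_swap (c := 0) ?_
      rw [postLieRelators_anticyclic]
      exact .inl rfl

lemma koszulDual_rel : (comTrias k).koszulDual.rel = Submodule.span k (Set.range
    (fiberSum (treeBasis (V := (comTriasGen k).czechDual) (comTriasBasis k).dualBasis)
      support)) := by
  ext f
  refine Iff.trans ?_ (mem_span_fiberSum_iff (treeBasis (comTriasBasis k)) _ support_supportRep
    (pairing (comTriasGen k)) (pairing_treeBasis _) f).symm
  rw [← comTrias_rel]
  rfl

lemma map_koszulDual_rel :
    (comTrias k).koszulDual.rel.map (mapFree (genIso k) 3) = (postLie k).rel := by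
  have h : ∀ i, mapFree (genIso k) 3
      (treeBasis (V := (comTriasGen k).czechDual) (comTriasBasis k).dualBasis i) =
        treeBasis (postLieBasis k) i := by
    rintro ⟨c, i, j⟩
    rw [treeBasis_apply, treeBasis_apply, mapFree_comb, genIso_dualBasis, genIso_dualBasis]
  rw [koszulDual_rel, postLie_rel]
  refine (Submodule.map_span _ _).trans ?_
  rw [← Set.range_comp]
  congr 2
  funext a
  refine (map_sum _ _ _).trans ?_
  exact Finset.sum_congr rfl fun i _ => h i

end Duality

theorem mainTheorem6 (k : Type u) [Field k] [CharZero k] :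
    (∃ φ : (comTrias k).koszulDual.gen.Iso (postLie k).gen,
      φ.equiv (dualStar k) = postLieCirc k ∧
      φ.equiv (dualBullet k) = postLieBracket k ∧
      (comTrias k).koszulDual.rel.map (FreeGen.mapFree φ 3) = (postLie k).rel ∧
      ∃ Φ : Operad.Iso (comTrias k).koszulDual.operad (postLie k).operad,
        ∀ f, Φ.equiv 2 ((comTrias k).koszulDual.op f) = (postLie k).op (φ.equiv f)) ∧
    Module.finrank k ((freeOperad (comTrias k).gen).obj 3) = 27 ∧
    Module.finrank k (comTrias k).rel = 20 ∧
    Module.finrank k (postLie k).rel = 7 := by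
  refine ⟨⟨genIso k, ?_, ?_, map_koszulDual_rel k,
    QuadraticData.exists_operadIso (comTrias k).koszulDual (postLie k) (genIso k)
      (map_koszulDual_rel k)⟩, ?_, ?_, ?_⟩
  · rw [dualStar_eq, postLieCirc_eq]
    exact genIso_dualBasis k 0
  · rw [dualBullet_eq, postLieBracket_eq]
    exact genIso_dualBasis k 2
  · have h : Module.finrank k ((freeOperad (comTriasGen k)).obj 3) =
        Fintype.card (Fin 3 × Fin 3 × Fin 3) :=
      Module.finrank_eq_card_basis (FreeGen.treeBasis (comTriasBasis k))
    exact h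
  · exact (congrArg (fun R : Submodule k ((freeOperad (comTriasGen k)).obj 3) =>
      Module.finrank k R) (comTrias_rel k)).trans (finrank_fiberDiff _ support_supportRep)
  · exact (congrArg (fun R : Submodule k ((freeOperad (postLieGen k)).obj 3) =>
      Module.finrank k R) (postLie_rel k)).trans (finrank_span_fiberSum _ support_supportRep)
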